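/- Two sets $\{p_1,\dots,p_n\}$ and $\{q_1,\dots,q_n\}$ of $n$ labeled points in general position in the plane (distinct points, no three collinear) have the same order type if for every triple $(i,j,k)$ of distinct indices, $p_k$ lies above (to the left of) the directed line from $p_i$ to $p_j$ if and only if $q_k$ lies above the directed line from $q_i$ to $q_j$. Let $g(n,\alpha)$ be the number of different order types of $n$ labeled points in general position that can be realized by points whose coordinates are nonnegative integers smaller than $n^{\alpha}$. If $\alpha \ge 2.5$, then \[ g(n,\alpha) \ge \exp\bigl(3n\log n - O(n\log\log n)\bigr), \] that is, there are constants $C>0$ and $n_0$, independent of $\alpha$, such that $g(n,\alpha)\ge \exp(3n\log n - C\,n\log\log n)$ for all $\alpha\ge 2.5$ and all integers $n\ge n_0$. -/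

import Mathlib

/-- The point `r` lies strictly above (i.e. strictly to the left of) the line through `p` and `q`
directed from `p` to `q`: the triple `p, q, r` is counterclockwise. -/
def AboveLine (p q r : ℝ × ℝ) : Prop :=
  0 < (q.1 - p.1) * (r.2 - p.2) - (q.2 - p.2) * (r.1 - p.1)

/-- A labeled family of points in the plane is in general position: the points are distinct and
no three of them are collinear. -/
def InGeneralPosition {n : ℕ} (p : Fin n → ℝ × ℝ) : Prop :=
  Function.Injective p ∧
    ∀ i j k : Fin n, i ≠ j → i ≠ k → j ≠ k → ¬ Collinear ℝ {p i, p j, p k}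

/-- Sets of `n` labeled points in general position in the plane. -/
abbrev PointConfig (n : ℕ) : Type := {p : Fin n → ℝ × ℝ // InGeneralPosition p}

/-- Two labeled point sets have the same order type if they have the same above-below
relationships. The labels are respected: no relabeling is allowed. -/
def SameOrderType {n : ℕ} (S T : PointConfig n) : Prop :=
  ∀ i j k : Fin n, i ≠ j → i ≠ k → j ≠ k →
    (AboveLine (S.1 i) (S.1 j) (S.1 k) ↔ AboveLine (T.1 i) (T.1 j) (T.1 k))

/-- Having the same order type is an equivalence relation. -/
instance orderTypeSetoid (n : ℕ) : Setoid (PointConfig n) where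
  r := SameOrderType
  iseqv :=
    { refl := fun _ _ _ _ _ _ _ => Iff.rfl
      symm := fun h i j k hij hik hjk => (h i j k hij hik hjk).symm
      trans := fun h h' i j k hij hik hjk => (h i j k hij hik hjk).trans (h' i j k hij hik hjk) }

/-- The (realizable, labeled) order types of `n` points in general position. -/
def PlanarOrderType (n : ℕ) : Type := Quotient (orderTypeSetoid n)

/-- There are finitely many order types of `n` points, so that counting them by `Set.ncard`
is meaningful. -/
instance orderTypeFinite (n : ℕ) : Finite (PlanarOrderType n) := by
  let f : PlanarOrderType n → (Fin n → Fin n → Fin n → Prop) := fun t =>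
    Quotient.lift (s := orderTypeSetoid n)
      (fun S i j k => i ≠ j ∧ i ≠ k ∧ j ≠ k ∧ AboveLine (S.1 i) (S.1 j) (S.1 k))
      (by
        intro S T h
        funext i j k
        apply propext
        constructor
        · rintro ⟨a, b, c, d⟩
          exact ⟨a, b, c, (h i j k a b c).1 d⟩
        · rintro ⟨a, b, c, d⟩
          exact ⟨a, b, c, (h i j k a b c).2 d⟩) t
  apply Finite.of_injective f
  intro s t
  refine Quotient.inductionOn₂ s t ?_
  intro S T h
  apply Quotient.sound
  intro i j k a b c
  have h' := congrFun (congrFun (congrFun h i) j) k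
  constructor
  · intro d
    exact (h'.mp ⟨a, b, c, d⟩).2.2.2
  · intro d
    exact (h'.mpr ⟨a, b, c, d⟩).2.2.2

/-- The points of `S` belong to the integer grid of side `s`: their coordinates are nonnegative
integers smaller than `s`. -/
def InGrid {n : ℕ} (s : ℝ) (S : PointConfig n) : Prop :=
  ∀ i : Fin n, ∃ a b : ℕ, (a : ℝ) < s ∧ (b : ℝ) < s ∧ S.1 i = ((a : ℝ), (b : ℝ))

/-- `gridOrderTypes n α` is the number `g(n, α)` of different order types of `n` points that are
realizable with nonnegative integer coordinates smaller than `n ^ α`. -/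
noncomputable def gridOrderTypes (n : ℕ) (α : ℝ) : ℕ :=
  Set.ncard {t : PlanarOrderType n |
    ∃ S : PointConfig n, InGrid ((n : ℝ) ^ α) S ∧ Quotient.mk (orderTypeSetoid n) S = t}

/-! Points are inserted one at a time. If each partial configuration has at least `Q` generic
extensions by one point, pairwise told apart by orientations with earlier points, then `e`
insertions give `Q ^ e` different labeled order types (`exists_family_of_extensions`). It is enough
to have `Q` at least `n ^ 3` up to a polylogarithmic factor while all but O(n / log n) of the points
are inserted this way.

The distinctions come from a frame of `4 * k` points, with `k` about n / log n (`IsFrame`). Half of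
them span `k` nearly horizontal lines, which cut the lower part of the grid into `k` strips. The
others form two flat arcs of `k` points at the bottom and the top; the `k ^ 2` lines joining the
arcs are steep and cut each row into intervals. A new point can thus be told apart by its strip and,
on one chosen row of the strip, by its interval, which offers about `k * k ^ 2` choices.

The difficulty is that intervals may contain no usable column: crossings may cluster, and up to `m ^
2` columns are forbidden by collinearity. Call two lines close on a row if they cross it at distance
less than `d`. Lines with a common upper endpoint stay apart in the lower half (`crossing_apart`);
lines with different upper endpoints are close only on a short range of rows (`abs_row_sub_le`).
Summing a harmonic series bounds the number of close pairs over all rows (`sum_card_closePairs_le`),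
so averaging gives many strips with many good rows (`exists_good_strips`). On a good row
Cauchy-Schwarz spreads the crossings over many bins of length `d`, and most of the bins retained
contain an allowed column (`exists_separated_columns`). A grid side of at most n ^ 2.5 leaves room
for all this. -/

/-! ### Integer configurations and their order types -/

/-- Twice the signed area of the triangle `p q r`. -/
def orient (p q r : ℤ × ℤ) : ℤ :=
  (q.1 - p.1) * (r.2 - p.2) - (q.2 - p.2) * (r.1 - p.1)

/-- The first `m` points of `P` lie on different horizontal lines, and no three are collinear. -/
structure IsGeneric (m : ℕ) (P : ℕ → ℤ × ℤ) : Prop where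
  row_ne : ∀ i j, i < j → j < m → (P i).2 ≠ (P j).2
  orient_ne : ∀ i j l, i < j → j < l → l < m → orient (P i) (P j) (P l) ≠ 0

/-- The first `m` points of `P` lie in the grid of side `N`. -/
def InBox (N : ℕ) (m : ℕ) (P : ℕ → ℤ × ℤ) : Prop :=
  ∀ i < m, 0 ≤ (P i).1 ∧ (P i).1 < N ∧ 0 ≤ (P i).2 ∧ (P i).2 < N

/-- Some triple among the first `m` points is oriented differently in `P` and in `P'`. -/
def Distinguished (m : ℕ) (P P' : ℕ → ℤ × ℤ) : Prop :=
  ∃ i j l, i < j ∧ j < l ∧ l < m ∧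
    ¬ (0 < orient (P i) (P j) (P l) ↔ 0 < orient (P' i) (P' j) (P' l))

/-- The real point with given integer coordinates. -/
def toPlane (p : ℤ × ℤ) : ℝ × ℝ := ((p.1 : ℝ), (p.2 : ℝ))

theorem aboveLine_toPlane (p q r : ℤ × ℤ) :
    AboveLine (toPlane p) (toPlane q) (toPlane r) ↔ 0 < orient p q r := by
  simp only [AboveLine, toPlane, orient]
  norm_cast

theorem orient_eq_zero_of_collinear {p q r : ℤ × ℤ}
    (h : Collinear ℝ {toPlane p, toPlane q, toPlane r}) : orient p q r = 0 := by
  rw [collinear_iff_of_mem (p₀ := toPlane p) (by simp)] at h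
  obtain ⟨v, hv⟩ := h
  obtain ⟨a, ha⟩ := hv (toPlane q) (by simp)
  obtain ⟨b, hb⟩ := hv (toPlane r) (by simp)
  have ha1 := congrArg Prod.fst ha
  have ha2 := congrArg Prod.snd ha
  have hb1 := congrArg Prod.fst hb
  have hb2 := congrArg Prod.snd hb
  simp [toPlane] at ha1 ha2 hb1 hb2
  have : ((orient p q r : ℤ) : ℝ) = 0 := by
    unfold orient
    push_cast
    rw [ha1, ha2, hb1, hb2]
    ring
  exact_mod_cast this

theorem orient_swap_left (p q r : ℤ × ℤ) : orient q p r = -orient p q r := by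
  unfold orient; ring

theorem orient_swap_right (p q r : ℤ × ℤ) : orient p r q = -orient p q r := by
  unfold orient; ring

theorem IsGeneric.orient_ne_zero {m : ℕ} {P : ℕ → ℤ × ℤ} (h : IsGeneric m P) {i j l : ℕ}
    (hi : i < m) (hj : j < m) (hl : l < m) (hij : i ≠ j) (hil : i ≠ l) (hjl : j ≠ l) :
    orient (P i) (P j) (P l) ≠ 0 := by
  have e1 := orient_swap_left
  have e2 := orient_swap_right
  rcases lt_or_gt_of_ne hij with a | a <;> rcases lt_or_gt_of_ne hil with b | b <;>
    rcases lt_or_gt_of_ne hjl with c | c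
  · exact h.orient_ne _ _ _ a c hl
  · rw [e2]; exact neg_ne_zero.2 (h.orient_ne _ _ _ b c hj)
  · omega
  · rw [e2, e1, neg_neg]; exact h.orient_ne _ _ _ b a hj
  · rw [e1]; exact neg_ne_zero.2 (h.orient_ne _ _ _ a b hl)
  · omega
  · rw [e1, e2, neg_neg]; exact h.orient_ne _ _ _ c b hi
  · rw [e1, e2, e1, neg_neg]; exact neg_ne_zero.2 (h.orient_ne _ _ _ c a hi)

theorem IsGeneric.inGeneralPosition {n : ℕ} {P : ℕ → ℤ × ℤ} (h : IsGeneric n P) :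
    InGeneralPosition (fun i : Fin n => toPlane (P i)) := by
  constructor
  · intro i j hij
    by_contra hne
    have h2 : (P i).2 = (P j).2 := by
      have := congrArg Prod.snd hij
      simpa [toPlane] using this
    rcases lt_or_gt_of_ne hne with hl | hl
    · exact h.row_ne i j hl j.2 h2
    · exact h.row_ne j i hl i.2 h2.symm
  · intro i j l hij hil hjl hc
    exact h.orient_ne_zero i.2 j.2 l.2 (fun e => hij (Fin.ext e)) (fun e => hil (Fin.ext e))
      (fun e => hjl (Fin.ext e)) (orient_eq_zero_of_collinear hc)

/-- Pairwise distinguished integer configurations realize different order types. -/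
theorem card_le_gridOrderTypes {n N : ℕ} {α : ℝ} (hN : (N : ℝ) ≤ (n : ℝ) ^ α)
    {ι : Type} [Fintype ι] (F : ι → ℕ → ℤ × ℤ) (hF : ∀ a, IsGeneric n (F a))
    (hbox : ∀ a, InBox N n (F a)) (hd : ∀ a b, a ≠ b → Distinguished n (F a) (F b)) :
    Fintype.card ι ≤ gridOrderTypes n α := by
  classical
  let S : ι → PointConfig n := fun a => ⟨fun i => toPlane (F a i), (hF a).inGeneralPosition⟩
  let f : ι → PlanarOrderType n := fun a => Quotient.mk (orderTypeSetoid n) (S a)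
  have hinj : Function.Injective f := by
    intro a b hab
    by_contra hne
    obtain ⟨i, j, l, hij, hjl, hl, hn⟩ := hd a b hne
    have h : SameOrderType (S a) (S b) := Quotient.exact hab
    have h3 := h ⟨i, by omega⟩ ⟨j, by omega⟩ ⟨l, hl⟩ (by simp; omega) (by simp; omega)
      (by simp; omega)
    simp only [S, aboveLine_toPlane] at h3
    exact hn h3
  have hsub : Set.range f ⊆ {t : PlanarOrderType n |
      ∃ S : PointConfig n, InGrid ((n : ℝ) ^ α) S ∧ Quotient.mk (orderTypeSetoid n) S = t} := by
    rintro _ ⟨a, rfl⟩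
    refine ⟨S a, ?_, rfl⟩
    intro i
    obtain ⟨h1, h2, h3, h4⟩ := hbox a i i.2
    refine ⟨(F a i).1.toNat, (F a i).2.toNat, ?_, ?_, ?_⟩
    · refine lt_of_lt_of_le ?_ hN
      exact_mod_cast (by omega : (F a i).1.toNat < N)
    · refine lt_of_lt_of_le ?_ hN
      exact_mod_cast (by omega : (F a i).2.toNat < N)
    · simp only [S, toPlane]
      have e1 : (((F a i).1.toNat : ℤ) : ℝ) = ((F a i).1 : ℝ) := by rw [Int.toNat_of_nonneg h1]
      have e2 : (((F a i).2.toNat : ℤ) : ℝ) = ((F a i).2 : ℝ) := by rw [Int.toNat_of_nonneg h3]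
      rw [← e1, ← e2]
      rfl
  have h1 := Set.ncard_le_ncard hsub (Set.toFinite _)
  rw [Set.ncard_range_of_injective hinj, Nat.card_eq_fintype_card] at h1
  exact h1

/-! ### Counting by one-point extensions -/

/-- If every admissible configuration of fewer than `n` points has at least `Q` admissible one-point
extensions that earlier points tell apart, then the numbers of pairwise distinguished
configurations multiply. -/
theorem exists_family_of_extensions (V : ℕ → (ℕ → ℤ × ℤ) → Prop) (m₀ Q : ℕ) (P₀ : ℕ → ℤ × ℤ)
    (h₀ : V m₀ P₀) (e : ℕ)
    (hstep : ∀ m P, m₀ ≤ m → m < m₀ + e → V m P → ∃ C : Finset (ℤ × ℤ), Q ≤ C.card ∧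
      (∀ p ∈ C, V (m + 1) (Function.update P m p)) ∧
      ∀ p ∈ C, ∀ p' ∈ C, p ≠ p' → ∃ i j, i < j ∧ j < m ∧
        ¬ (0 < orient (P i) (P j) p ↔ 0 < orient (P i) (P j) p')) :
    ∃ (ι : Type) (_ : Fintype ι) (F : ι → ℕ → ℤ × ℤ), Fintype.card ι = Q ^ e ∧
      (∀ a, V (m₀ + e) (F a)) ∧ ∀ a b, a ≠ b → Distinguished (m₀ + e) (F a) (F b) := by
  classical
  induction e with
  | zero =>
    refine ⟨Unit, inferInstance, fun _ => P₀, by simp, fun _ => h₀, fun a b h => ?_⟩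
    exact absurd (Subsingleton.elim a b) h
  | succ e ih =>
    obtain ⟨ι, hι, F, hcard, hV, hd⟩ := ih (fun m P h1 h2 => hstep m P h1 (by omega))
    have hC : ∀ a, ∃ c : Fin Q → ℤ × ℤ,
        (∀ q, V (m₀ + e + 1) (Function.update (F a) (m₀ + e) (c q))) ∧
        ∀ q q', q ≠ q' → ∃ i j, i < j ∧ j < m₀ + e ∧
          ¬ (0 < orient (F a i) (F a j) (c q) ↔ 0 < orient (F a i) (F a j) (c q')) := by
      intro a
      obtain ⟨C, hQ, h1, h2⟩ := hstep (m₀ + e) (F a) (by omega) (by omega) (hV a)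
      let g : Fin Q → ℤ × ℤ := fun q => (C.equivFin.symm (Fin.castLE hQ q) : ℤ × ℤ)
      refine ⟨g, fun q => h1 _ (C.equivFin.symm _).2, fun q q' hq => ?_⟩
      refine h2 _ (C.equivFin.symm _).2 _ (C.equivFin.symm _).2 fun h => hq ?_
      exact Fin.castLE_injective hQ (C.equivFin.symm.injective (Subtype.ext h))
    choose c hc1 hc2 using hC
    refine ⟨ι × Fin Q, inferInstance,
      fun a => Function.update (F a.1) (m₀ + e) (c a.1 a.2), ?_, ?_, ?_⟩
    · rw [Fintype.card_prod, hcard, Fintype.card_fin, pow_succ]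
    · exact fun a => hc1 a.1 a.2
    -- Extensions of the same configuration differ on a triple ending in the new point; for
    -- different parents the old distinguishing triple survives, since only the value at the new
    -- index changes.
    · rintro ⟨a, q⟩ ⟨b, q'⟩ hne
      by_cases hab : a = b
      · subst hab
        obtain ⟨i, j, hij, hj, hn⟩ := hc2 a q q' (fun h => hne (by rw [h]))
        refine ⟨i, j, m₀ + e, hij, hj, by omega, ?_⟩
        simpa [Function.update_of_ne (by omega : i ≠ m₀ + e),
          Function.update_of_ne (by omega : j ≠ m₀ + e)] using hn
      · obtain ⟨i, j, l, hij, hjl, hl, hn⟩ := hd a b hab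
        refine ⟨i, j, l, hij, hjl, by omega, ?_⟩
        simpa [Function.update_of_ne (by omega : i ≠ m₀ + e),
          Function.update_of_ne (by omega : j ≠ m₀ + e),
          Function.update_of_ne (by omega : l ≠ m₀ + e)] using hn

/-! ### Greedy placement of generic points -/

/-- On a fresh row, all but at most `m ^ 2` columns keep a configuration generic. -/
theorem IsGeneric.exists_forbidden_columns {m : ℕ} {P : ℕ → ℤ × ℤ} (h : IsGeneric m P) {y : ℤ}
    (hy : ∀ i < m, (P i).2 ≠ y) :
    ∃ K : Finset ℤ, K.card ≤ m ^ 2 ∧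
      ∀ x ∉ K, IsGeneric (m + 1) (Function.update P m (x, y)) := by
  classical
  -- These are the columns where lines through two earlier points meet row `y`. Rounding in the
  -- integer division is harmless: when the new point is collinear with such a pair, the quotient is
  -- exact.
  refine ⟨(Finset.range m ×ˢ Finset.range m).image fun e =>
    (P e.1).1 + (((P e.2).1 - (P e.1).1) * (y - (P e.1).2)) / ((P e.2).2 - (P e.1).2), ?_, ?_⟩
  · refine Finset.card_image_le.trans ?_
    rw [Finset.card_product, Finset.card_range, sq]
  · intro x hx
    have hu : ∀ i, i < m → Function.update P m (x, y) i = P i := fun i hi =>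
      Function.update_of_ne (by omega) _ _
    constructor
    · intro i j hij hj
      rcases Nat.lt_succ_iff_lt_or_eq.1 hj with hj' | rfl
      · rw [hu i (by omega), hu j hj']
        exact h.row_ne i j hij hj'
      · rw [hu i hij, Function.update_self]
        exact hy i hij
    · intro i j l hij hjl hl
      rcases Nat.lt_succ_iff_lt_or_eq.1 hl with hl' | rfl
      · rw [hu i (by omega), hu j (by omega), hu l hl']
        exact h.orient_ne i j l hij hjl hl'
      · rw [hu i (by omega), hu j hjl, Function.update_self]
        intro h0
        apply hx
        simp only [Finset.mem_image, Finset.mem_product, Finset.mem_range]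
        refine ⟨(i, j), ⟨by omega, hjl⟩, ?_⟩
        have hne : (P j).2 - (P i).2 ≠ 0 := sub_ne_zero.2 (h.row_ne i j hij hjl).symm
        have h1 : ((P j).1 - (P i).1) * (y - (P i).2) = ((P j).2 - (P i).2) * (x - (P i).1) := by
          unfold orient at h0
          linarith
        simp only [h1, Int.mul_ediv_cancel_left _ hne]
        ring

/-- Points can be appended on prescribed fresh rows, inside prescribed large sets of columns. -/
theorem IsGeneric.exists_append {m : ℕ} {P : ℕ → ℤ × ℤ} (h : IsGeneric m P) (ρ : ℕ → ℤ)
    (C : ℕ → Finset ℤ) (t : ℕ) (hρ : ∀ i < m, ∀ s < t, (P i).2 ≠ ρ s)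
    (hinj : ∀ r s, r < s → s < t → ρ r ≠ ρ s) (hC : ∀ s < t, (m + t) ^ 2 < (C s).card) :
    ∃ P' : ℕ → ℤ × ℤ, IsGeneric (m + t) P' ∧ (∀ i < m, P' i = P i) ∧
      ∀ s < t, (P' (m + s)).1 ∈ C s ∧ (P' (m + s)).2 = ρ s := by
  classical
  induction t with
  | zero => exact ⟨P, h, fun _ _ => rfl, fun s hs => absurd hs (Nat.not_lt_zero s)⟩
  | succ t ih =>
    obtain ⟨P', hg, hP, hnew⟩ := ih (fun i hi s hs => hρ i hi s (by omega))
      (fun r s hr hs => hinj r s hr (by omega))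
      (fun s hs => lt_of_le_of_lt (Nat.pow_le_pow_left (by omega) 2) (hC s (by omega)))
    have hy : ∀ i < m + t, (P' i).2 ≠ ρ t := by
      intro i hi
      by_cases him : i < m
      · rw [hP i him]
        exact hρ i him t (by omega)
      · obtain ⟨s, rfl⟩ := Nat.exists_eq_add_of_le (not_lt.1 him)
        rw [(hnew s (by omega)).2]
        exact hinj s t (by omega) (by omega)
    obtain ⟨K, hK, hext⟩ := hg.exists_forbidden_columns hy
    have hlt : K.card < (C t).card :=
      hK.trans_lt (lt_of_le_of_lt (Nat.pow_le_pow_left (by omega) 2) (hC t (by omega)))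
    obtain ⟨x, hxC, hxK⟩ := Finset.exists_mem_notMem_of_card_lt_card hlt
    refine ⟨Function.update P' (m + t) (x, ρ t), hext x hxK, ?_, ?_⟩
    · intro i hi
      rw [Function.update_of_ne (by omega), hP i hi]
    · intro s hs
      rcases Nat.lt_succ_iff_lt_or_eq.1 hs with hs' | rfl
      · rw [Function.update_of_ne (by omega)]
        exact hnew s hs'
      · rw [Function.update_self]
        exact ⟨hxC, rfl⟩

/-! ### The frame: two arcs and a ladder of nearly horizontal lines -/

/-- The abscissa `u * i + i ^ 2` of the `i`-th point of a flat parabolic arc. -/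
def arcCol (u i : ℕ) : ℤ := u * i + (i : ℤ) ^ 2

/-- Two parabolic arcs of `k` points, one on the lowest and one on the highest rows of the grid. -/
def twoArcs (k u N i : ℕ) : ℤ × ℤ :=
  if i < k then (arcCol u i, (i : ℤ)) else (arcCol u (i - k), N - 1 - ((i - k : ℕ) : ℤ))

theorem twoArcs_low {k u N i : ℕ} (h : i < k) : twoArcs k u N i = (arcCol u i, (i : ℤ)) :=
  if_pos h

theorem twoArcs_high (k u N j : ℕ) :
    twoArcs k u N (k + j) = (arcCol u j, (N : ℤ) - 1 - j) := by
  simp [twoArcs]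

theorem arcCol_nonneg (u i : ℕ) : 0 ≤ arcCol u i := by
  unfold arcCol; positivity

theorem arcCol_sub (u i j : ℕ) : arcCol u j - arcCol u i = ((j : ℤ) - i) * (u + j + i) := by
  unfold arcCol; ring

/-- On a single arc the quadratic term makes the orientation a Vandermonde product. For a mixed
triple, a chord of one arc moves at least one column per row, so at the height of the other arc it
has drifted by more than the `N / 4` columns that contain both arcs. -/
theorem isGeneric_twoArcs {k u N : ℕ} (hu : 0 < u) (hk : 8 * k ≤ N)
    (hcol : ∀ i < k, 4 * arcCol u i ≤ N) : IsGeneric (2 * k) (twoArcs k u N) := by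
  have hlow : ∀ i, i < k → twoArcs k u N i = (arcCol u i, (i : ℤ)) := fun i => twoArcs_low
  have hhigh : ∀ i, k ≤ i → i < 2 * k → ∃ j, j < k ∧ i = k + j ∧
      twoArcs k u N i = (arcCol u j, (N : ℤ) - 1 - j) := by
    intro i hi hi2
    obtain ⟨j, rfl⟩ := Nat.exists_eq_add_of_le hi
    exact ⟨j, by omega, rfl, twoArcs_high k u N j⟩
  constructor
  · intro i j hij hj
    by_cases hi : i < k
    · by_cases hj' : j < k
      · rw [hlow i hi, hlow j hj']
        simp only
        omega
      · obtain ⟨b, hb, rfl, e⟩ := hhigh j (by omega) hj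
        rw [hlow i hi, e]
        simp only
        omega
    · obtain ⟨a, ha, rfl, e⟩ := hhigh i (by omega) (by omega)
      obtain ⟨b, hb, rfl, e'⟩ := hhigh j (by omega) hj
      rw [e, e']
      simp only
      omega
  · intro i j l hij hjl hl
    by_cases hi : i < k
    · by_cases hj : j < k
      · by_cases hl' : l < k
        · rw [hlow i hi, hlow j hj, hlow l hl']
          have : orient (arcCol u i, (i : ℤ)) (arcCol u j, (j : ℤ)) (arcCol u l, (l : ℤ)) =
              ((j : ℤ) - i) * (l - i) * (j - l) := by
            simp only [orient, arcCol]; ring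
          rw [this]
          refine mul_ne_zero (mul_ne_zero ?_ ?_) ?_ <;> omega
        · obtain ⟨b, hb, rfl, e⟩ := hhigh l (by omega) hl
          rw [hlow i hi, hlow j hj, e]
          have : orient (arcCol u i, (i : ℤ)) (arcCol u j, (j : ℤ)) (arcCol u b, (N : ℤ) - 1 - b) =
              ((j : ℤ) - i) * ((u + j + i) * (N - 1 - b - i) - (arcCol u b - arcCol u i)) := by
            simp only [orient, arcCol_sub u i j]; ring
          rw [this]
          have h1 := hcol b hb
          have h2 := arcCol_nonneg u i
          have h3 : (1 : ℤ) * (N - 1 - b - i) ≤ (u + j + i) * (N - 1 - b - i) := by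
            apply mul_le_mul_of_nonneg_right <;> omega
          refine mul_ne_zero (by omega) (ne_of_gt ?_)
          omega
      · obtain ⟨b, hb, rfl, e⟩ := hhigh j (by omega) (by omega)
        obtain ⟨c, hc, rfl, e'⟩ := hhigh l (by omega) hl
        rw [hlow i hi, e, e']
        have : orient (arcCol u i, (i : ℤ)) (arcCol u b, (N : ℤ) - 1 - b)
            (arcCol u c, (N : ℤ) - 1 - c) =
              -(((c : ℤ) - b) * ((u + c + b) * (N - 1 - b - i) + (arcCol u b - arcCol u i))) := by
          simp only [orient, arcCol]; ring
        rw [this]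
        have h1 := hcol i hi
        have h2 := arcCol_nonneg u b
        have h3 : (1 : ℤ) * (N - 1 - b - i) ≤ (u + c + b) * (N - 1 - b - i) := by
          apply mul_le_mul_of_nonneg_right <;> omega
        refine neg_ne_zero.2 (mul_ne_zero (by omega) (ne_of_gt ?_))
        omega
    · obtain ⟨a, ha, rfl, e⟩ := hhigh i (by omega) (by omega)
      obtain ⟨b, hb, rfl, e'⟩ := hhigh j (by omega) (by omega)
      obtain ⟨c, hc, rfl, e''⟩ := hhigh l (by omega) hl
      rw [e, e', e'']
      have : orient (arcCol u a, (N : ℤ) - 1 - a) (arcCol u b, (N : ℤ) - 1 - b)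
          (arcCol u c, (N : ℤ) - 1 - c) = -(((b : ℤ) - a) * (c - a) * (b - c)) := by
        simp only [orient, arcCol]; ring
      rw [this]
      refine neg_ne_zero.2 (mul_ne_zero (mul_ne_zero ?_ ?_) ?_) <;> omega

/-- The first `2 * k` points of `P` are two parabolic arcs; the other `2 * k` points span `k` almost
horizontal lines, at heights `Y + s * H`. -/
structure IsFrame (k u N H Y : ℕ) (P : ℕ → ℤ × ℤ) : Prop where
  arcs : ∀ i < 2 * k, P i = twoArcs k u N i
  left_row : ∀ s < k, (P (2 * k + s)).2 = Y + s * H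
  left_nonneg : ∀ s < k, 0 ≤ (P (2 * k + s)).1
  left_lt : ∀ s < k, 4 * (P (2 * k + s)).1 < N
  right_row : ∀ s < k, (P (3 * k + s)).2 = Y + s * H + 1
  right_le : ∀ s < k, 3 * N ≤ 4 * (P (3 * k + s)).1
  right_lt : ∀ s < k, (P (3 * k + s)).1 < N

/-- The ladder points are appended greedily to the arcs: each has its own row and a window of `N /
4` columns, more than the at most `(4 * k) ^ 2` columns that collinearity forbids. -/
theorem exists_isFrame {k u N H Y : ℕ} (hu : 0 < u) (hk : 8 * k ≤ N)
    (hcol : ∀ i < k, 4 * arcCol u i ≤ N) (hH : 2 ≤ H) (hY : k ≤ Y) (hYN : Y + k * H + k < N)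
    (hkN : (4 * k) ^ 2 < N / 4) :
    ∃ P, IsGeneric (4 * k) P ∧ InBox N (4 * k) P ∧ IsFrame k u N H Y P := by
  classical
  let ρ : ℕ → ℤ := fun s => if s < k then Y + s * H else Y + ((s - k : ℕ) : ℤ) * H + 1
  let C : ℕ → Finset ℤ := fun s =>
    if s < k then Finset.Ico 0 ((N / 4 : ℕ) : ℤ) else Finset.Ico ((N : ℤ) - (N / 4 : ℕ)) N
  have hρlow : ∀ s, s < k → ρ s = Y + s * H := fun s hs => if_pos hs
  have hρhigh : ∀ s, ρ (k + s) = Y + s * H + 1 := by intro s; simp [ρ]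
  have hClow : ∀ s, s < k → C s = Finset.Ico 0 ((N / 4 : ℕ) : ℤ) := fun s hs => if_pos hs
  have hChigh : ∀ s, C (k + s) = Finset.Ico ((N : ℤ) - (N / 4 : ℕ)) N := by intro s; simp [C]
  have hmul : ∀ s : ℕ, s < k → (s : ℤ) * H + H ≤ k * H := by
    intro s hs
    have : (s + 1) * H ≤ k * H := Nat.mul_le_mul_right H hs
    have h2 : (((s + 1) * H : ℕ) : ℤ) ≤ ((k * H : ℕ) : ℤ) := by exact_mod_cast this
    push_cast at h2
    linarith
  have hnn : ∀ s : ℕ, (0 : ℤ) ≤ (s : ℤ) * H := fun s => by positivity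
  have hρmono : ∀ r s : ℕ, r < s → (r : ℤ) * H + 2 ≤ s * H := by
    intro r s hrs
    have : (r + 1) * H ≤ s * H := Nat.mul_le_mul_right H hrs
    have h2 : (((r + 1) * H : ℕ) : ℤ) ≤ ((s * H : ℕ) : ℤ) := by exact_mod_cast this
    push_cast at h2
    linarith [(by exact_mod_cast hH : (2 : ℤ) ≤ H)]
  have hYN' : (Y : ℤ) + k * H + k < N := by exact_mod_cast hYN
  have hρrange : ∀ s < 2 * k, (k : ℤ) ≤ ρ s ∧ ρ s < (N : ℤ) - k := by
    intro s hs
    by_cases h : s < k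
    · rw [hρlow s h]
      have := hmul s h
      have := hnn s
      constructor <;> linarith [(by exact_mod_cast hY : (k : ℤ) ≤ Y), (by positivity : (0 : ℤ) ≤ H)]
    · obtain ⟨t, rfl⟩ := Nat.exists_eq_add_of_le (not_lt.1 h)
      rw [hρhigh t]
      have := hmul t (by omega)
      have := hnn t
      constructor <;> linarith [(by exact_mod_cast hY : (k : ℤ) ≤ Y),
        (by exact_mod_cast hH : (2 : ℤ) ≤ H)]
  have hcases : ∀ i < 2 * k, ∃ j < k, twoArcs k u N i = (arcCol u j, (j : ℤ)) ∨
      twoArcs k u N i = (arcCol u j, (N : ℤ) - 1 - j) := by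
    intro i hi
    by_cases h : i < k
    · exact ⟨i, h, Or.inl (twoArcs_low h)⟩
    · obtain ⟨j, rfl⟩ := Nat.exists_eq_add_of_le (not_lt.1 h)
      exact ⟨j, by omega, Or.inr (twoArcs_high k u N j)⟩
  obtain ⟨P, hg, hP, hnew⟩ := (isGeneric_twoArcs hu hk hcol).exists_append ρ C (2 * k)
    (by
      intro i hi s hs
      have := hρrange s hs
      obtain ⟨j, hj, e | e⟩ := hcases i hi <;> rw [e] <;> simp only <;> omega)
    (by
      intro r s hrs hs
      by_cases h : s < k
      · rw [hρlow s h, hρlow r (by omega)]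
        have := hρmono r s hrs
        omega
      · obtain ⟨t, rfl⟩ := Nat.exists_eq_add_of_le (not_lt.1 h)
        rw [hρhigh t]
        by_cases h' : r < k
        · rw [hρlow r h']
          rcases lt_trichotomy r t with a | rfl | a
          · have := hρmono r t a
            omega
          · omega
          · have := hρmono t r a
            omega
        · obtain ⟨q, rfl⟩ := Nat.exists_eq_add_of_le (not_lt.1 h')
          rw [hρhigh q]
          have := hρmono q t (by omega)
          omega)
    (by
      intro s hs
      have e : 2 * k + 2 * k = 4 * k := by ring
      rw [e]
      by_cases h : s < k
      · rw [hClow s h]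
        rw [Int.card_Ico]
        omega
      · obtain ⟨t, rfl⟩ := Nat.exists_eq_add_of_le (not_lt.1 h)
        rw [hChigh t, Int.card_Ico]
        omega)
  have e4 : 2 * k + 2 * k = 4 * k := by ring
  rw [e4] at hg
  have hleft : ∀ s < k, (0 ≤ (P (2 * k + s)).1 ∧ (P (2 * k + s)).1 < (N / 4 : ℕ)) ∧
      (P (2 * k + s)).2 = Y + s * H := by
    intro s hs
    have := hnew s (by omega)
    rwa [hClow s hs, hρlow s hs, Finset.mem_Ico] at this
  have hright : ∀ s < k, (((N : ℤ) - (N / 4 : ℕ)) ≤ (P (3 * k + s)).1 ∧ (P (3 * k + s)).1 < N) ∧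
      (P (3 * k + s)).2 = Y + s * H + 1 := by
    intro s hs
    have := hnew (k + s) (by omega)
    rwa [hChigh s, hρhigh s, Finset.mem_Ico, show 2 * k + (k + s) = 3 * k + s by ring] at this
  refine ⟨P, hg, ?_, hP, ?_, ?_, ?_, ?_, ?_, ?_⟩
  · intro i hi
    by_cases h : i < 2 * k
    · rw [hP i h]
      obtain ⟨j, hj, e | e⟩ := hcases i h <;> rw [e] <;>
        have h1 := hcol j hj <;> have h2 := arcCol_nonneg u j <;>
        refine ⟨h2, ?_, ?_, ?_⟩ <;> simp only <;> omega
    · by_cases h3 : i < 3 * k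
      · obtain ⟨s, rfl⟩ := Nat.exists_eq_add_of_le (not_lt.1 h)
        have h1 := hleft s (by omega)
        have h2 := hρrange s (by omega)
        rw [hρlow s (by omega), ← h1.2] at h2
        omega
      · obtain ⟨s, rfl⟩ := Nat.exists_eq_add_of_le (not_lt.1 h3)
        have h1 := hright s (by omega)
        have h2 := hρrange (k + s) (by omega)
        rw [hρhigh s, ← h1.2] at h2
        omega
  · exact fun s hs => (hleft s hs).2
  · exact fun s hs => (hleft s hs).1.1
  · intro s hs
    have := (hleft s hs).1.2
    omega
  · exact fun s hs => (hright s hs).2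
  · intro s hs
    have := (hright s hs).1.1
    omega
  · exact fun s hs => (hright s hs).1.2

/-- The ladder line climbs one row over more than `N / 2` columns, so it rises by less than two rows
across the whole grid and at column 0 has dropped less than one row below its left point. The lower
strips therefore lie entirely below it. -/
theorem IsFrame.orient_neg {k u N H Y s : ℕ} {P : ℕ → ℤ × ℤ} (h : IsFrame k u N H Y P)
    (hs : s < k) {x y : ℤ} (hx : 0 ≤ x) (hy : y < Y + s * H) :
    orient (P (2 * k + s)) (P (3 * k + s)) (x, y) < 0 := by
  have h1 := h.left_lt s hs
  have h2 := h.right_le s hs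
  have h3 := h.left_nonneg s hs
  have h4 := h.right_lt s hs
  unfold orient
  rw [h.left_row s hs, h.right_row s hs]
  simp only
  have h5 : ((P (3 * k + s)).1 - (P (2 * k + s)).1) * (y - (Y + s * H)) ≤
      ((P (3 * k + s)).1 - (P (2 * k + s)).1) * (-1) := by
    apply mul_le_mul_of_nonneg_left <;> omega
  have h6 : ((Y : ℤ) + s * H + 1 - (Y + s * H)) = 1 := by ring
  rw [h6]
  omega

/-- By the same slope estimate, three rows of margin put a point above the line anywhere in the
grid. -/
theorem IsFrame.orient_pos {k u N H Y s : ℕ} {P : ℕ → ℤ × ℤ} (h : IsFrame k u N H Y P)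
    (hs : s < k) {x y : ℤ} (hx : x < N) (hy : Y + s * H + 3 ≤ y) :
    0 < orient (P (2 * k + s)) (P (3 * k + s)) (x, y) := by
  have h1 := h.left_lt s hs
  have h2 := h.right_le s hs
  have h3 := h.left_nonneg s hs
  unfold orient
  rw [h.left_row s hs, h.right_row s hs]
  simp only
  have h5 : ((P (3 * k + s)).1 - (P (2 * k + s)).1) * 3 ≤
      ((P (3 * k + s)).1 - (P (2 * k + s)).1) * (y - (Y + s * H)) := by
    apply mul_le_mul_of_nonneg_left <;> omega
  have h6 : ((Y : ℤ) + s * H + 1 - (Y + s * H)) = 1 := by ring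
  rw [h6]
  omega

/-! ### Steep lines between the arcs and their crossings with rows -/

/-- The inverse slope of the line through the `p.1`-th point of the lower arc and the `p.2`-th point
of the upper arc. -/
noncomputable def invSlope (u N : ℕ) (p : ℕ × ℕ) : ℝ :=
  ((arcCol u p.2 : ℝ) - arcCol u p.1) / ((N : ℝ) - 1 - p.1 - p.2)

/-- The abscissa at which that line crosses the row `y`. -/
noncomputable def crossing (u N : ℕ) (p : ℕ × ℕ) (y : ℝ) : ℝ :=
  arcCol u p.1 + invSlope u N p * (y - p.1)

theorem crossing_sub (u N : ℕ) (p : ℕ × ℕ) (y z : ℝ) :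
    crossing u N p y - crossing u N p z = invSlope u N p * (y - z) := by
  unfold crossing; ring

theorem arcCol_cast_bounds {k u N : ℕ} (hcol : ∀ i < k, 4 * arcCol u i ≤ N) {i : ℕ} (hi : i < k) :
    (0 : ℝ) ≤ arcCol u i ∧ 4 * (arcCol u i : ℝ) ≤ N :=
  ⟨by exact_mod_cast arcCol_nonneg u i, by exact_mod_cast hcol i hi⟩

theorem height_bound {k N i j : ℕ} (hk : 8 * k ≤ N) (hi : i < k) (hj : j < k) :
    (N : ℝ) / 2 + 1 ≤ (N : ℝ) - 1 - i - j := by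
  have h1 : (i : ℝ) + 1 ≤ k := by exact_mod_cast hi
  have h2 : (j : ℝ) + 1 ≤ k := by exact_mod_cast hj
  have h3 : 8 * (k : ℝ) ≤ N := by exact_mod_cast hk
  have h4 : (1 : ℝ) ≤ k := by linarith [(Nat.cast_nonneg i : (0 : ℝ) ≤ i)]
  linarith

theorem abs_invSlope_le {k u N : ℕ} (hk : 8 * k ≤ N) (hcol : ∀ i < k, 4 * arcCol u i ≤ N)
    {p : ℕ × ℕ} (h1 : p.1 < k) (h2 : p.2 < k) : |invSlope u N p| ≤ 1 / 2 := by
  have hh := height_bound hk h1 h2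
  obtain ⟨a1, a2⟩ := arcCol_cast_bounds hcol h1
  obtain ⟨b1, b2⟩ := arcCol_cast_bounds hcol h2
  have hN : (0 : ℝ) ≤ N := Nat.cast_nonneg N
  unfold invSlope
  rw [abs_div, abs_of_pos (by linarith : (0 : ℝ) < (N : ℝ) - 1 - p.1 - p.2), div_le_iff₀ (by linarith),
    abs_le]
  constructor <;> linarith

theorem crossing_upper {k u N : ℕ} (hk : 8 * k ≤ N) {p : ℕ × ℕ} (h1 : p.1 < k) (h2 : p.2 < k) :
    crossing u N p ((N : ℝ) - 1 - p.2) = arcCol u p.2 := by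
  have hh := height_bound hk h1 h2
  have hne : (N : ℝ) - 1 - p.1 - p.2 ≠ 0 := by
    have hN : (0 : ℝ) ≤ N := Nat.cast_nonneg N
    linarith
  unfold crossing invSlope
  rw [show (N : ℝ) - 1 - p.2 - p.1 = (N : ℝ) - 1 - p.1 - p.2 by ring, div_mul_cancel₀ _ hne]
  ring

/-- The orientation is the positive height difference of the endpoints times the signed horizontal
distance to the line. This turns separation of columns by crossings into a difference of order
types. -/
theorem orient_pos_iff_lt_crossing {k u N : ℕ} (hk : 8 * k ≤ N) {p : ℕ × ℕ} (h1 : p.1 < k)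
    (h2 : p.2 < k) (x y : ℤ) :
    0 < orient (arcCol u p.1, (p.1 : ℤ)) (arcCol u p.2, (N : ℤ) - 1 - p.2) (x, y) ↔
      (x : ℝ) < crossing u N p y := by
  have hh := height_bound hk h1 h2
  have hpos : (0 : ℝ) < (N : ℝ) - 1 - p.1 - p.2 := by
    have hN : (0 : ℝ) ≤ N := Nat.cast_nonneg N
    linarith
  have key : ((orient (arcCol u p.1, (p.1 : ℤ)) (arcCol u p.2, (N : ℤ) - 1 - p.2) (x, y) : ℤ) : ℝ) =
      ((N : ℝ) - 1 - p.1 - p.2) * (crossing u N p y - x) := by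
    unfold crossing invSlope orient
    field_simp
    push_cast
    ring
  rw [← Int.cast_pos (R := ℝ), key, mul_pos_iff_of_pos_left hpos, sub_pos]

/-- Between the arcs the crossing is a convex combination of the two endpoint columns. -/
theorem crossing_bounds {k u N : ℕ} (hk : 8 * k ≤ N) (hcol : ∀ i < k, 4 * arcCol u i ≤ N)
    {p : ℕ × ℕ} (h1 : p.1 < k) (h2 : p.2 < k) {y : ℝ} (hy : (k : ℝ) ≤ y) (hy' : y ≤ (N : ℝ) - k) :
    0 ≤ crossing u N p y ∧ 4 * crossing u N p y ≤ N := by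
  have hh := height_bound hk h1 h2
  have hpos : (0 : ℝ) < (N : ℝ) - 1 - p.1 - p.2 := by
    have hN : (0 : ℝ) ≤ N := Nat.cast_nonneg N
    linarith
  obtain ⟨a1, a2⟩ := arcCol_cast_bounds hcol h1
  obtain ⟨b1, b2⟩ := arcCol_cast_bounds hcol h2
  have hi : (p.1 : ℝ) + 1 ≤ k := by exact_mod_cast h1
  have hj : (p.2 : ℝ) + 1 ≤ k := by exact_mod_cast h2
  have key : crossing u N p y = (((N : ℝ) - 1 - p.2 - y) * arcCol u p.1 +
      (y - p.1) * arcCol u p.2) / ((N : ℝ) - 1 - p.1 - p.2) := by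
    unfold crossing invSlope
    field_simp
    ring
  rw [key]
  have c1 : (0 : ℝ) ≤ (N : ℝ) - 1 - p.2 - y := by linarith
  have c2 : (0 : ℝ) ≤ y - p.1 := by linarith
  constructor
  · positivity
  · rw [mul_div_assoc', div_le_iff₀ hpos]
    have := mul_le_mul_of_nonneg_left a2 c1
    have := mul_le_mul_of_nonneg_left b2 c2
    linarith

theorem le_abs_arcCol_sub (u : ℕ) (i j : ℕ) :
    (u : ℝ) * |(i : ℝ) - j| ≤ |(arcCol u i : ℝ) - arcCol u j| := by
  have h : (arcCol u i : ℝ) - arcCol u j = ((i : ℝ) - j) * (u + i + j) := by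
    unfold arcCol; push_cast; ring
  rw [h, abs_mul, mul_comm]
  refine mul_le_mul_of_nonneg_left ?_ (abs_nonneg _)
  refine le_trans ?_ (le_abs_self _)
  have := Nat.cast_nonneg (α := ℝ) i
  have := Nat.cast_nonneg (α := ℝ) j
  linarith

theorem one_le_abs_cast_sub {i j : ℕ} (h : i ≠ j) : (1 : ℝ) ≤ |(i : ℝ) - j| := by
  have : (1 : ℤ) ≤ |(i : ℤ) - j| := Int.one_le_abs (by omega)
  exact_mod_cast this

/-- Two lines through the same point of the upper arc stay apart in the lower half of the grid. -/
theorem crossing_apart {k u N d : ℕ} (hk : 8 * k ≤ N) (hcol : ∀ i < k, 4 * arcCol u i ≤ N)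
    (hu : 4 * (k + d) ≤ u) {p q : ℕ × ℕ} (hp1 : p.1 < k) (hp2 : p.2 < k) (hq1 : q.1 < k)
    (hpq : p.2 = q.2) (hne : p.1 ≠ q.1) {y : ℝ} (hyN : 2 * y ≤ N) :
    (d : ℝ) ≤ |crossing u N p y - crossing u N q y| := by
  by_contra! hlt
  have hq2 : q.2 < k := hpq ▸ hp2
  have hp := abs_le.1 (abs_invSlope_le hk hcol hp1 hp2)
  have hq := abs_le.1 (abs_invSlope_le hk hcol hq1 hq2)
  set m := invSlope u N p - invSlope u N q with hm
  have hk' : 8 * (k : ℝ) ≤ N := by exact_mod_cast hk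
  have hu' : 4 * ((k : ℝ) + d) ≤ u := by exact_mod_cast hu
  have hi : (p.1 : ℝ) + 1 ≤ k := by exact_mod_cast hp1
  have hi' : (q.1 : ℝ) + 1 ≤ k := by exact_mod_cast hq1
  have hj : (p.2 : ℝ) + 1 ≤ k := by exact_mod_cast hp2
  have hi0 := Nat.cast_nonneg (α := ℝ) p.1
  have hi0' := Nat.cast_nonneg (α := ℝ) q.1
  have hd0 := Nat.cast_nonneg (α := ℝ) d
  -- The lines meet at their common upper point, at least `N / 4` rows above `y`, so being close at
  -- `y` forces `|m| * N < 4 * d`. Following them down to the arc puts their lower endpoints within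
  -- `k + 4 * d` columns, less than the spacing `u`; the term `k` pays for the endpoints lying on
  -- different rows.
  have hz : crossing u N p y - crossing u N q y = -(m * ((N : ℝ) - 1 - p.2 - y)) := by
    have e1 := crossing_upper (u := u) hk hp1 hp2
    have e2 := crossing_upper (u := u) hk hq1 hq2
    have e3 := crossing_sub u N p ((N : ℝ) - 1 - p.2) y
    have e4 := crossing_sub u N q ((N : ℝ) - 1 - p.2) y
    rw [← hpq] at e2
    rw [hm]
    linarith
  rw [hz, abs_neg, abs_mul] at hlt
  have hgap : (N : ℝ) / 4 ≤ |(N : ℝ) - 1 - p.2 - y| := by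
    refine le_trans ?_ (le_abs_self _)
    linarith
  have hmN : |m| * ((N : ℝ) / 4) < d :=
    lt_of_le_of_lt (mul_le_mul_of_nonneg_left hgap (abs_nonneg m)) hlt
  have e5 : (arcCol u p.1 : ℝ) - arcCol u q.1 =
      invSlope u N p * p.1 - invSlope u N q * q.1 - m * ((N : ℝ) - 1 - p.2) := by
    have e1 := crossing_upper (u := u) hk hp1 hp2
    have e2 := crossing_upper (u := u) hk hq1 hq2
    rw [← hpq] at e2
    unfold crossing at e1 e2
    rw [hm]
    linarith
  have h6 : |m * ((N : ℝ) - 1 - p.2)| ≤ |m| * N := by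
    rw [abs_mul]
    refine mul_le_mul_of_nonneg_left ?_ (abs_nonneg m)
    rw [abs_le]
    have := Nat.cast_nonneg (α := ℝ) p.2
    constructor <;> linarith
  have h7 := le_abs_arcCol_sub u p.1 q.1
  have h8 := one_le_abs_cast_sub hne
  have h9 : (u : ℝ) * 1 ≤ u * |(p.1 : ℝ) - q.1| :=
    mul_le_mul_of_nonneg_left h8 (Nat.cast_nonneg u)
  rw [e5] at h7
  have h10 := abs_le.1 h6
  have h12 : |invSlope u N p * p.1 - invSlope u N q * q.1 - m * ((N : ℝ) - 1 - p.2)| ≤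
      k + |m| * N := by
    rw [abs_le]
    constructor <;> nlinarith
  linarith

/-- Two rows on which the lines through different points of the upper arc nearly meet are close. -/
theorem abs_row_sub_le {k u N d : ℕ} (hk : 8 * k ≤ N) (hcol : ∀ i < k, 4 * arcCol u i ≤ N)
    (hu : 4 * (k + d) ≤ u) {p q : ℕ × ℕ} (hp1 : p.1 < k) (hp2 : p.2 < k) (hq1 : q.1 < k)
    (hq2 : q.2 < k) (hne : p.2 ≠ q.2) {y z : ℝ} (hy : 0 ≤ y) (hyN : y ≤ N - 1)
    (hcy : |crossing u N p y - crossing u N q y| < d)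
    (hcz : |crossing u N p z - crossing u N q z| < d) :
    (u : ℝ) * |(p.2 : ℝ) - q.2| * |y - z| ≤ 4 * d * N := by
  have hp := abs_le.1 (abs_invSlope_le hk hcol hp1 hp2)
  have hq := abs_le.1 (abs_invSlope_le hk hcol hq1 hq2)
  set m := invSlope u N p - invSlope u N q with hm
  have hu' : 4 * ((k : ℝ) + d) ≤ u := by exact_mod_cast hu
  have hj : (p.2 : ℝ) + 1 ≤ k := by exact_mod_cast hp2
  have hj' : (q.2 : ℝ) + 1 ≤ k := by exact_mod_cast hq2
  have hj0 := Nat.cast_nonneg (α := ℝ) p.2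
  have hj0' := Nat.cast_nonneg (α := ℝ) q.2
  have hd0 := Nat.cast_nonneg (α := ℝ) d
  have hN0 := Nat.cast_nonneg (α := ℝ) N
  have e1 := crossing_upper (u := u) hk hp1 hp2
  have e2 := crossing_upper (u := u) hk hq1 hq2
  have e3 := crossing_sub u N p ((N : ℝ) - 1 - p.2) y
  have e4 := crossing_sub u N q ((N : ℝ) - 1 - q.2) y
  -- Following the lines from row `y` up to their distinct endpoints bounds `|m|` from below, since
  -- these are at least `u * |p.2 - q.2|` columns apart and the errors `d + k` are at most `u / 4`.
  -- Closeness on both rows bounds `|m| * |y - z|` by `2 * d`; combining the two bounds `|y - z|`.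
  have e5 : (arcCol u p.2 : ℝ) - arcCol u q.2 = m * ((N : ℝ) - 1 - y) +
      (crossing u N p y - crossing u N q y) - invSlope u N p * p.2 + invSlope u N q * q.2 := by
    rw [hm]
    linarith
  have h6 : |m * ((N : ℝ) - 1 - y)| ≤ |m| * N := by
    rw [abs_mul]
    refine mul_le_mul_of_nonneg_left ?_ (abs_nonneg m)
    rw [abs_le]
    constructor <;> linarith
  have h7 := le_abs_arcCol_sub u p.2 q.2
  have h8 := one_le_abs_cast_sub hne
  have h9 : (u : ℝ) * 1 ≤ u * |(p.2 : ℝ) - q.2| :=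
    mul_le_mul_of_nonneg_left h8 (Nat.cast_nonneg u)
  have h10 := abs_le.1 h6
  have h11 := abs_lt.1 hcy
  rw [e5] at h7
  have h12 : |m * ((N : ℝ) - 1 - y) +
      (crossing u N p y - crossing u N q y) - invSlope u N p * p.2 + invSlope u N q * q.2| ≤
      |m| * N + d + k := by
    rw [abs_le]
    constructor <;> nlinarith
  have h13 : (u : ℝ) * |(p.2 : ℝ) - q.2| ≤ 2 * (|m| * N) := by linarith
  have h14 : |m| * |y - z| ≤ 2 * d := by
    rw [← abs_mul]
    have e6 := crossing_sub u N p y z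
    have e7 := crossing_sub u N q y z
    have e8 : m * (y - z) = (crossing u N p y - crossing u N q y) -
        (crossing u N p z - crossing u N q z) := by
      rw [hm]
      linarith
    rw [e8]
    have h15 := abs_lt.1 hcz
    rw [abs_le]
    constructor <;> linarith
  calc (u : ℝ) * |(p.2 : ℝ) - q.2| * |y - z| ≤ 2 * (|m| * N) * |y - z| :=
        mul_le_mul_of_nonneg_right h13 (abs_nonneg _)
    _ = 2 * N * (|m| * |y - z|) := by ring
    _ ≤ 2 * N * (2 * d) := mul_le_mul_of_nonneg_left h14 (by positivity)
    _ = 4 * d * N := by ring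

/-! ### Counting close pairs -/

/-- The indices on either side of `j` each contribute at most a harmonic sum; the term `i = j`
vanishes because `0⁻¹ = 0`. -/
theorem sum_inv_dist_le (k j : ℕ) (hj : j < k) :
    ∑ i ∈ Finset.range k, (|(j : ℝ) - i|)⁻¹ ≤ 2 * (1 + Real.log k) := by
  have hH : ∀ n ≤ k, ∑ t ∈ Finset.range n, ((t : ℝ) + 1)⁻¹ ≤ 1 + Real.log k := by
    intro n hn
    have h1 := harmonic_le_one_add_log k
    have h2 : ((harmonic k : ℚ) : ℝ) = ∑ t ∈ Finset.range k, ((t : ℝ) + 1)⁻¹ := by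
      unfold harmonic
      push_cast
      rfl
    rw [h2] at h1
    refine le_trans ?_ h1
    exact Finset.sum_le_sum_of_subset_of_nonneg (Finset.range_mono hn)
      (fun _ _ _ => by positivity)
  rw [← Finset.sum_range_add_sum_Ico _ hj.le, Finset.sum_Ico_eq_sum_range]
  have a : ∑ i ∈ Finset.range j, (|(j : ℝ) - i|)⁻¹ = ∑ t ∈ Finset.range j, ((t : ℝ) + 1)⁻¹ := by
    rw [← Finset.sum_range_reflect]
    refine Finset.sum_congr rfl fun t ht => ?_
    have ht := Finset.mem_range.1 ht
    have e : ((j - 1 - t : ℕ) : ℝ) = j - 1 - t := by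
      rw [Nat.cast_sub (by omega), Nat.cast_sub (by omega)]
      simp
    rw [e, show (j : ℝ) - (j - 1 - t) = t + 1 by ring, abs_of_nonneg (by positivity)]
  obtain ⟨c, hc⟩ : ∃ c, k - j = c + 1 := ⟨k - j - 1, by omega⟩
  have b : ∑ t ∈ Finset.range (k - j), (|(j : ℝ) - ((j + t : ℕ) : ℝ)|)⁻¹ =
      ∑ t ∈ Finset.range c, ((t : ℝ) + 1)⁻¹ := by
    rw [hc, Finset.sum_range_succ']
    simp only [Nat.cast_add, sub_add_cancel_left, abs_neg]
    simp only [Nat.cast_zero, abs_zero, inv_zero, add_zero]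
    refine Finset.sum_congr rfl fun t _ => ?_
    rw [abs_of_nonneg (by positivity)]
    simp
  rw [a, b]
  have := hH j hj.le
  have := hH c (by omega)
  linarith

theorem card_mul_le_of_diam {S : Finset ℕ} {w W : ℝ} (hw : 0 ≤ w) (hW : 0 ≤ W)
    (h : ∀ a ∈ S, ∀ b ∈ S, w * |(a : ℝ) - b| ≤ W) : w * S.card ≤ W + w := by
  rcases S.eq_empty_or_nonempty with rfl | hS
  · simp; positivity
  · have h1 : S ⊆ Finset.Icc (S.min' hS) (S.max' hS) := fun x hx =>
      Finset.mem_Icc.2 ⟨S.min'_le x hx, S.le_max' x hx⟩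
    have h2 := Finset.card_le_card h1
    have hle : S.min' hS ≤ S.max' hS := S.min'_le _ (S.max'_mem hS)
    rw [Nat.card_Icc] at h2
    have h3 := h _ (S.max'_mem hS) _ (S.min'_mem hS)
    have h4 : (S.card : ℝ) ≤ |(S.max' hS : ℝ) - S.min' hS| + 1 := by
      have e : ((S.max' hS - S.min' hS : ℕ) : ℝ) = (S.max' hS : ℝ) - S.min' hS :=
        Nat.cast_sub hle
      rw [← e, abs_of_nonneg (Nat.cast_nonneg _)]
      exact_mod_cast (by omega : S.card ≤ S.max' hS - S.min' hS + 1)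
    nlinarith

/-- The pairs of lines between the arcs. -/
abbrev linePairs (k : ℕ) : Finset ((ℕ × ℕ) × (ℕ × ℕ)) :=
  (Finset.range k ×ˢ Finset.range k) ×ˢ (Finset.range k ×ˢ Finset.range k)

open Classical in
/-- The pairs of lines between the arcs that cross the row `y` at distance less than `d`. -/
noncomputable def closePairs (k u N d y : ℕ) : Finset ((ℕ × ℕ) × (ℕ × ℕ)) :=
  {e ∈ linePairs k | |crossing u N e.1 y - crossing u N e.2 y| < d}

-- For different upper endpoints the close rows have diameter at most `4 * d * n` divided by the
-- index distance, and passing from diameter to cardinality costs the fifth `d * n`. For a common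
-- upper endpoint the convention `0⁻¹ = 0` kills the last term: distinct lines are then never close,
-- and equal lines are close on every row.
open Classical in
theorem card_close_rows_le {k n u N d Y M : ℕ} (hN : N = n * u) (hkn : k ≤ n) (hd : 1 ≤ d)
    (hk : 8 * k ≤ N) (hcol : ∀ i < k, 4 * arcCol u i ≤ N) (hu : 4 * (k + d) ≤ u)
    (hM : 2 * (Y + M) ≤ N) {e : (ℕ × ℕ) × (ℕ × ℕ)} (he : e ∈ linePairs k) :
    ((Finset.range M).filter fun h =>
      |crossing u N e.1 ((Y + h : ℕ) : ℝ) - crossing u N e.2 ((Y + h : ℕ) : ℝ)| < d).card ≤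
      (if e.1 = e.2 then (M : ℝ) else 0) + 5 * d * n * (|(e.1.2 : ℝ) - e.2.2|)⁻¹ := by
  obtain ⟨p, q⟩ := e
  simp only [linePairs, Finset.mem_product, Finset.mem_range] at he
  obtain ⟨⟨hp1, hp2⟩, hq1, hq2⟩ := he
  simp only
  set S := (Finset.range M).filter fun h =>
      |crossing u N p ((Y + h : ℕ) : ℝ) - crossing u N q ((Y + h : ℕ) : ℝ)| < d with hS
  have hmem : ∀ h ∈ S, h < M ∧
      |crossing u N p ((Y + h : ℕ) : ℝ) - crossing u N q ((Y + h : ℕ) : ℝ)| < d := by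
    intro h hh
    rw [hS, Finset.mem_filter, Finset.mem_range] at hh
    exact hh
  by_cases hpq : p.2 = q.2
  · rw [hpq]
    simp only [sub_self, abs_zero, inv_zero, mul_zero, add_zero]
    split_ifs with heq
    · have : S.card ≤ M := by simpa using Finset.card_filter_le (Finset.range M) _
      exact_mod_cast this
    · have hne : p.1 ≠ q.1 := fun h => heq (Prod.ext h hpq)
      have : S = ∅ := by
        refine Finset.eq_empty_of_forall_notMem fun h hh => ?_
        obtain ⟨h1, h2⟩ := hmem h hh
        refine absurd h2 (not_lt.2 (crossing_apart hk hcol hu hp1 hp2 hq1 hpq hne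
          ?_))
        exact_mod_cast (by omega : 2 * (Y + h) ≤ N)
      simp [this]
  · have hpq' : p ≠ q := fun h => hpq (by rw [h])
    rw [if_neg hpq', zero_add]
    have hδ := one_le_abs_cast_sub hpq
    set δ := |(p.2 : ℝ) - q.2| with hδd
    have hu0 : (0 : ℝ) < u := by exact_mod_cast (by omega : 0 < u)
    have hδn : δ ≤ n := by
      have h1 : (p.2 : ℝ) ≤ k := by exact_mod_cast hp2.le
      have h2 : (q.2 : ℝ) ≤ k := by exact_mod_cast hq2.le
      have h3 : (k : ℝ) ≤ n := by exact_mod_cast hkn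
      rw [hδd, abs_le]
      constructor <;> linarith [Nat.cast_nonneg (α := ℝ) p.2, Nat.cast_nonneg (α := ℝ) q.2]
    have hdiam : ∀ a ∈ S, ∀ b ∈ S, δ * |(a : ℝ) - b| ≤ 4 * d * n := by
      intro a ha b hb
      obtain ⟨ha1, ha2⟩ := hmem a ha
      obtain ⟨hb1, hb2⟩ := hmem b hb
      have hle : ((Y + a : ℕ) : ℝ) ≤ (N : ℝ) - 1 := by
        have : ((Y + a + 1 : ℕ) : ℝ) ≤ N := by exact_mod_cast (by omega : Y + a + 1 ≤ N)
        push_cast at this ⊢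
        linarith
      have := abs_row_sub_le hk hcol hu hp1 hp2 hq1 hq2 hpq (Nat.cast_nonneg _) hle ha2 hb2
      rw [← hδd] at this
      have e1 : ((Y + a : ℕ) : ℝ) - ((Y + b : ℕ) : ℝ) = a - b := by push_cast; ring
      have e2 : (N : ℝ) = n * u := by exact_mod_cast hN
      rw [e1, e2] at this
      have h3 : (δ * |(a : ℝ) - b|) * u ≤ (4 * d * n) * u := by linarith
      exact le_of_mul_le_mul_right h3 hu0
    have hcard := card_mul_le_of_diam (by linarith) (by positivity) hdiam
    have hdn : δ ≤ d * n := by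
      have : (1 : ℝ) ≤ d := by exact_mod_cast hd
      nlinarith [Nat.cast_nonneg (α := ℝ) n]
    rw [← div_eq_mul_inv, le_div_iff₀ (by linarith)]
    linarith

/-- Double counting, pair by pair. The diagonal gives `k ^ 2 * M`; the other pairs give a harmonic
sum, and `hlog` is precisely what bounds it by `k ^ 2 * N`. -/
theorem sum_card_closePairs_le {k n u N d Y M : ℕ} (hN : N = n * u) (hkn : k ≤ n) (hd : 1 ≤ d)
    (hk : 8 * k ≤ N) (hcol : ∀ i < k, 4 * arcCol u i ≤ N) (hu : 4 * (k + d) ≤ u)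
    (hM : 2 * (Y + M) ≤ N) (hlog : 10 * (d : ℝ) * k * (1 + Real.log k) ≤ u) :
    ∑ h ∈ Finset.range M, ((closePairs k u N d (Y + h)).card : ℝ) ≤ (k : ℝ) ^ 2 * (M + N) := by
  classical
  have h1 : ∑ h ∈ Finset.range M, ((closePairs k u N d (Y + h)).card : ℝ) =
      ∑ e ∈ linePairs k, (((Finset.range M).filter fun h =>
        |crossing u N e.1 ((Y + h : ℕ) : ℝ) - crossing u N e.2 ((Y + h : ℕ) : ℝ)| < d).card : ℝ) := by
    simp only [closePairs, Finset.card_filter, Nat.cast_sum]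
    exact Finset.sum_comm
  rw [h1]
  refine (Finset.sum_le_sum fun e he =>
    card_close_rows_le hN hkn hd hk hcol hu hM he).trans ?_
  rw [Finset.sum_add_distrib]
  have h2 : ∑ e ∈ linePairs k, (if e.1 = e.2 then (M : ℝ) else 0) = (k : ℝ) ^ 2 * M := by
    rw [Finset.sum_product]
    simp only [Finset.sum_ite_eq]
    rw [Finset.sum_ite_mem, Finset.inter_self, Finset.sum_const, Finset.card_product,
      Finset.card_range, nsmul_eq_mul]
    push_cast
    ring
  have h3 : ∑ e ∈ linePairs k, 5 * (d : ℝ) * n * (|(e.1.2 : ℝ) - e.2.2|)⁻¹ ≤ (k : ℝ) ^ 2 * N := by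
    rw [← Finset.mul_sum, Finset.sum_product]
    have h4 : ∀ p ∈ Finset.range k ×ˢ Finset.range k,
        ∑ q ∈ Finset.range k ×ˢ Finset.range k, (|(p.2 : ℝ) - q.2|)⁻¹ ≤
          k * (2 * (1 + Real.log k)) := by
      intro p hp
      rw [Finset.sum_product]
      simp only [Finset.sum_const, Finset.card_range, nsmul_eq_mul]
      exact mul_le_mul_of_nonneg_left
        (sum_inv_dist_le k p.2 (Finset.mem_range.1 (Finset.mem_product.1 hp).2)) (Nat.cast_nonneg k)
    have h5 := Finset.sum_le_sum h4
    rw [Finset.sum_const, Finset.card_product, Finset.card_range, nsmul_eq_mul] at h5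
    push_cast at h5
    have e2 : (N : ℝ) = n * u := by exact_mod_cast hN
    calc _ ≤ 5 * (d : ℝ) * n * ((k : ℝ) * k * (k * (2 * (1 + Real.log k)))) :=
          mul_le_mul_of_nonneg_left h5 (by positivity)
      _ = ((k : ℝ) ^ 2 * n) * (10 * (d : ℝ) * k * (1 + Real.log k)) := by ring
      _ ≤ ((k : ℝ) ^ 2 * n) * u := mul_le_mul_of_nonneg_left hlog (by positivity)
      _ = (k : ℝ) ^ 2 * N := by rw [e2]; ring
  rw [h2]
  linarith

/-! ### Good rows and separated columns -/

/-- Cauchy-Schwarz applied to the fibre sizes: few coincidences force a large image. -/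
theorem card_sq_le_card_image_mul {α β : Type*} [DecidableEq β] (S : Finset α) (f : α → β) :
    S.card ^ 2 ≤ (S.image f).card * ((S ×ˢ S).filter fun e => f e.1 = f e.2).card := by
  classical
  have h1 : ((S ×ˢ S).filter fun e => f e.1 = f e.2).card =
      ∑ b ∈ S.image f, (S.filter fun a => f a = b).card ^ 2 := by
    rw [Finset.card_eq_sum_card_fiberwise (f := fun e => f e.1) (t := S.image f)]
    · refine Finset.sum_congr rfl fun b _ => ?_
      rw [sq, ← Finset.card_product]
      congr 1
      ext ⟨x, y⟩
      simp only [Finset.mem_filter, Finset.mem_product]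
      constructor
      · rintro ⟨⟨⟨hx, hy⟩, h⟩, hb⟩
        exact ⟨⟨hx, hb⟩, hy, h ▸ hb⟩
      · rintro ⟨⟨hx, hb⟩, hy, hb'⟩
        exact ⟨⟨⟨hx, hy⟩, hb.trans hb'.symm⟩, hb⟩
    · intro e he
      have he := Finset.mem_filter.1 (Finset.mem_coe.1 he)
      exact Finset.mem_coe.2 (Finset.mem_image_of_mem f (Finset.mem_product.1 he.1).1)
  rw [h1]
  conv_lhs => rw [Finset.card_eq_sum_card_image f S]
  exact sq_sum_le_card_mul_sum_sq

/-- On a row with few close pairs there are many allowed columns, any two of which are separated by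
a line between the arcs. -/
theorem exists_separated_columns {k u N d y T q : ℕ} {K : Finset ℤ} (hk0 : 0 < k) (hd : 1 ≤ d)
    (hk : 8 * k ≤ N) (hcol : ∀ i < k, 4 * arcCol u i ≤ N) (hdN : 4 * d ≤ N) (hy : k ≤ y)
    (hyN : y + k ≤ N) (hT : 0 < T) (hclose : (closePairs k u N d y).card ≤ T * k ^ 2)
    (hK : K.card ≤ d * q) (hq : 4 * T * q ≤ k ^ 2) :
    ∃ X : Finset ℤ, q ≤ X.card ∧ (∀ x ∈ X, x ∉ K ∧ 0 ≤ x ∧ x < N) ∧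
      ∀ x ∈ X, ∀ x' ∈ X, x < x' → ∃ p : ℕ × ℕ, p.1 < k ∧ p.2 < k ∧
        (x : ℝ) < crossing u N p y ∧ crossing u N p y ≤ x' := by
  classical
  have hd0 : (0 : ℝ) < d := by exact_mod_cast hd
  set S := Finset.range k ×ˢ Finset.range k with hS
  -- The row is cut into bins of length `d`. Lines crossing in the same bin form a close pair, so at
  -- least `k ^ 2 / T`, hence at least `4 * q`, bins contain a crossing.
  let f : ℕ × ℕ → ℤ := fun p => ⌊crossing u N p y / d⌋
  have hf : ∀ p, (f p : ℝ) * d ≤ crossing u N p y ∧ crossing u N p y < (f p + 1) * d := by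
    intro p
    constructor
    · rw [← le_div_iff₀ hd0]
      exact Int.floor_le _
    · rw [← div_lt_iff₀ hd0]
      exact Int.lt_floor_add_one _
  have hSk : S.card = k ^ 2 := by simp [hS, sq]
  have hB : 4 * q ≤ (S.image f).card := by
    have h1 := card_sq_le_card_image_mul S f
    have h2 : ((S ×ˢ S).filter fun e => f e.1 = f e.2) ⊆ closePairs k u N d y := by
      intro e he
      obtain ⟨he1, he2⟩ := Finset.mem_filter.1 he
      refine Finset.mem_filter.2 ⟨he1, ?_⟩
      have a := hf e.1
      have b := hf e.2
      rw [← he2] at b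
      rw [abs_lt]
      constructor <;> nlinarith
    have h3 := (Finset.card_le_card h2).trans hclose
    rw [hSk] at h1
    have h4 : k ^ 2 * k ^ 2 ≤ (T * (S.image f).card) * k ^ 2 := by
      calc k ^ 2 * k ^ 2 = (k ^ 2) ^ 2 := by ring
        _ ≤ (S.image f).card * (T * k ^ 2) := h1.trans (Nat.mul_le_mul_left _ h3)
        _ = _ := by ring
    have h5 := Nat.le_of_mul_le_mul_right h4 (by positivity)
    have h6 : T * (4 * q) ≤ T * (S.image f).card := by
      calc T * (4 * q) = 4 * T * q := by ring
        _ ≤ _ := hq.trans h5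
    exact Nat.le_of_mul_le_mul_left h6 hT
  -- Keeping the bins of one parity costs half of them and leaves a spare bin after each.
  obtain ⟨B, hBsub, hBcard, r, hBr⟩ : ∃ B ⊆ S.image f, 2 * q ≤ B.card ∧
      ∃ r : ℤ, ∀ b ∈ B, b % 2 = r := by
    have h := Finset.card_filter_add_card_filter_not (s := S.image f) (fun b : ℤ => b % 2 = 0)
    by_cases hc : 2 * q ≤ ((S.image f).filter fun b : ℤ => b % 2 = 0).card
    · exact ⟨_, Finset.filter_subset _ _, hc, 0, fun b hb => (Finset.mem_filter.1 hb).2⟩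
    · refine ⟨_, Finset.filter_subset (fun b : ℤ => ¬ b % 2 = 0) _, by omega, 1, fun b hb => ?_⟩
      have := (Finset.mem_filter.1 hb).2
      omega
  have hsep : ∀ b ∈ B, ∀ b' ∈ B, b < b' → b + 2 ≤ b' := by
    intro b hb b' hb' hlt
    have := hBr b hb
    have := hBr b' hb'
    omega
  -- The column for `b` is taken from the next bin `b + 1`. For `b < b'` of equal parity, a crossing
  -- in bin `b'` then lies to the right of the column for `b` and to the left of the column for
  -- `b'`.
  let bin : ℤ → Finset ℤ := fun b => Finset.Ico ((b + 1) * d) ((b + 2) * d)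
  have hbin : ∀ b, (bin b).card = d := by
    intro b
    simp only [bin, Int.card_Ico]
    have : (b + 2) * (d : ℤ) - (b + 1) * d = d := by ring
    rw [this, Int.toNat_natCast]
  set U := B.filter fun b => ∃ x ∈ bin b, x ∉ K with hU
  -- A blocked bin uses up `d` forbidden columns, and at most `d * q` columns are forbidden, so at
  -- least `q` of the `2 * q` bins survive.
  have hbad : (B.filter fun b => ¬ ∃ x ∈ bin b, x ∉ K).card ≤ q := by
    set W := B.filter fun b => ¬ ∃ x ∈ bin b, x ∉ K with hW
    have h1 : d * W.card ≤ K.card := by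
      have hdis : (W : Set ℤ).PairwiseDisjoint bin := by
        intro b hb b' hb' hne
        rw [Function.onFun, Finset.disjoint_left]
        intro x hx hx'
        simp only [bin, Finset.mem_Ico] at hx hx'
        rcases lt_or_gt_of_ne hne with h | h
        · have : (b + 2) * (d : ℤ) ≤ (b' + 1) * d :=
            mul_le_mul_of_nonneg_right (by omega) (by omega)
          omega
        · have : (b' + 2) * (d : ℤ) ≤ (b + 1) * d :=
            mul_le_mul_of_nonneg_right (by omega) (by omega)
          omega
      have h2 : (W.biUnion bin).card = W.card * d := by
        rw [Finset.card_biUnion hdis, Finset.sum_congr rfl fun b _ => hbin b, Finset.sum_const,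
          smul_eq_mul]
      rw [mul_comm, ← h2]
      refine Finset.card_le_card fun x hx => ?_
      obtain ⟨b, hb, hxb⟩ := Finset.mem_biUnion.1 hx
      have := (Finset.mem_filter.1 hb).2
      push Not at this
      exact this x hxb
    exact Nat.le_of_mul_le_mul_left (h1.trans hK) hd
  have hUcard : q ≤ U.card := by
    have := Finset.card_filter_add_card_filter_not (s := B) (fun b => ∃ x ∈ bin b, x ∉ K)
    rw [← hU] at this
    omega
  have hch : ∀ b, ∃ x, b ∈ U → x ∈ bin b ∧ x ∉ K := by
    intro b
    by_cases hb : b ∈ U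
    · obtain ⟨x, hx⟩ := (Finset.mem_filter.1 hb).2
      exact ⟨x, fun _ => hx⟩
    · exact ⟨0, fun h => absurd h hb⟩
  choose c hc using hch
  have hcbin : ∀ b ∈ U, ((b : ℝ) + 1) * d ≤ c b ∧ (c b : ℝ) < (b + 2) * d := by
    intro b hb
    have h := (hc b hb).1
    simp only [bin, Finset.mem_Ico] at h
    exact ⟨by exact_mod_cast h.1, by exact_mod_cast h.2⟩
  have hUB : ∀ b ∈ U, b ∈ B := fun b hb => (Finset.mem_filter.1 hb).1
  have hmono : ∀ b ∈ U, ∀ b' ∈ U, b < b' → ∃ p : ℕ × ℕ, p.1 < k ∧ p.2 < k ∧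
      (c b : ℝ) < crossing u N p y ∧ crossing u N p y ≤ c b' := by
    intro b hb b' hb' hlt
    obtain ⟨p, hp, rfl⟩ := Finset.mem_image.1 (hBsub (hUB b' hb'))
    rw [hS, Finset.mem_product, Finset.mem_range, Finset.mem_range] at hp
    refine ⟨p, hp.1, hp.2, ?_, ?_⟩
    · have h2 : (b : ℝ) + 2 ≤ f p := by exact_mod_cast hsep b (hUB b hb) _ (hUB _ hb') hlt
      exact lt_of_lt_of_le ((hcbin b hb).2.trans_le (mul_le_mul_of_nonneg_right h2 hd0.le)) (hf p).1
    · exact (hf p).2.le.trans (hcbin _ hb').1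
  have hlt_of : ∀ b ∈ U, ∀ b' ∈ U, b < b' → c b < c b' := by
    intro b hb b' hb' hlt
    obtain ⟨p, -, -, h1, h2⟩ := hmono b hb b' hb' hlt
    exact_mod_cast h1.trans_le h2
  have hinj : Set.InjOn c U := by
    intro b hb b' hb' h
    rcases lt_trichotomy b b' with hl | hl | hl
    · exact absurd h (hlt_of b hb b' hb' hl).ne
    · exact hl
    · exact absurd h (hlt_of b' hb' b hb hl).ne'
  refine ⟨U.image c, ?_, ?_, ?_⟩
  · rwa [Finset.card_image_of_injOn hinj]
  · intro x hx
    obtain ⟨b, hb, rfl⟩ := Finset.mem_image.1 hx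
    refine ⟨(hc b hb).2, ?_⟩
    obtain ⟨p, hp, rfl⟩ := Finset.mem_image.1 (hBsub (hUB b hb))
    rw [hS, Finset.mem_product, Finset.mem_range, Finset.mem_range] at hp
    have hyN' : (y : ℝ) + k ≤ N := by exact_mod_cast hyN
    have hb2 := crossing_bounds hk hcol hp.1 hp.2 (y := y) (by exact_mod_cast hy) (by linarith)
    have h1 := hf p
    have h2 := hcbin _ hb
    have hdN' : 4 * (d : ℝ) ≤ N := by exact_mod_cast hdN
    have a : (0 : ℝ) ≤ c (f p) := by nlinarith
    have b : (c (f p) : ℝ) < N := by nlinarith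
    exact ⟨by exact_mod_cast a, by exact_mod_cast b⟩
  · intro x hx x' hx' hlt
    obtain ⟨b, hb, rfl⟩ := Finset.mem_image.1 hx
    obtain ⟨b', hb', rfl⟩ := Finset.mem_image.1 hx'
    refine hmono b hb b' hb' ?_
    by_contra hle
    rcases (not_lt.1 hle).eq_or_lt with h | h
    · rw [h] at hlt
      exact lt_irrefl _ hlt
    · exact lt_asymm hlt (hlt_of b' hb' b hb h)

/-- If there are few close pairs on average, then at least half of the strips of `H` rows consist for
at least one half of rows with few close pairs. -/
theorem exists_good_strips (c : ℕ → ℕ) {k H N T : ℕ} (hk0 : 0 < k) (hH : 0 < H)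
    (hsum : ∑ r ∈ Finset.range (k * H), c r ≤ k ^ 2 * (k * H + N))
    (hT : 4 * (k * H + N) ≤ T * (k * H)) :
    ∃ G ⊆ Finset.range k, k ≤ 2 * G.card ∧ ∀ s ∈ G, ∃ R : Finset ℕ, H ≤ 2 * R.card ∧
      ∀ r ∈ R, s * H ≤ r ∧ r < s * H + H ∧ c r ≤ T * k ^ 2 := by
  classical
  set B := (Finset.range (k * H)).filter fun r => ¬ c r ≤ T * k ^ 2 with hB
  -- Markov's inequality: at most a quarter of the rows are bad, so at most half of the strips can
  -- have more than half of their rows bad.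
  have hBcard : 4 * B.card ≤ k * H := by
    have h1 : B.card * (T * k ^ 2) ≤ k ^ 2 * (k * H + N) := by
      refine le_trans ?_ hsum
      refine le_trans ?_ (Finset.sum_le_sum_of_subset (Finset.filter_subset _ _ : B ⊆ _))
      rw [← smul_eq_mul]
      exact Finset.card_nsmul_le_sum _ _ _ fun r hr => (not_le.1 (Finset.mem_filter.1 hr).2).le
    have h2 : B.card * T ≤ k * H + N := by
      refine Nat.le_of_mul_le_mul_left (c := k ^ 2) ?_ (by positivity)
      calc k ^ 2 * (B.card * T) = B.card * (T * k ^ 2) := by ring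
        _ ≤ _ := h1
    refine Nat.le_of_mul_le_mul_right (c := k * H + N) ?_ (by positivity)
    calc 4 * B.card * (k * H + N) = B.card * (4 * (k * H + N)) := by ring
      _ ≤ B.card * (T * (k * H)) := Nat.mul_le_mul_left _ hT
      _ = (B.card * T) * (k * H) := by ring
      _ ≤ (k * H + N) * (k * H) := Nat.mul_le_mul_right _ h2
      _ = k * H * (k * H + N) := by ring
  let F : ℕ → Finset ℕ := fun s => B.filter fun r => r / H = s
  refine ⟨(Finset.range k).filter fun s => 2 * (F s).card ≤ H, Finset.filter_subset _ _, ?_, ?_⟩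
  · have h1 := Finset.card_filter_add_card_filter_not (s := Finset.range k)
      (fun s => 2 * (F s).card ≤ H)
    set W := (Finset.range k).filter fun s => ¬ 2 * (F s).card ≤ H with hW
    have h2 : ∑ s ∈ Finset.range k, (F s).card = B.card := by
      refine (Finset.card_eq_sum_card_fiberwise (f := fun r => r / H) fun r hr => ?_).symm
      have hr := Finset.mem_range.1 (Finset.mem_filter.1 (Finset.mem_coe.1 hr)).1
      exact Finset.mem_coe.2 (Finset.mem_range.2 ((Nat.div_lt_iff_lt_mul hH).2 hr))
    have h3 : W.card * H ≤ ∑ s ∈ W, 2 * (F s).card := by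
      rw [← smul_eq_mul]
      exact Finset.card_nsmul_le_sum _ _ _ fun s hs => (not_le.1 (Finset.mem_filter.1 hs).2).le
    have h4 : ∑ s ∈ W, 2 * (F s).card ≤ 2 * B.card := by
      rw [← Finset.mul_sum, ← h2]
      exact Nat.mul_le_mul_left _ (Finset.sum_le_sum_of_subset (Finset.filter_subset _ _))
    have h5 : 2 * W.card ≤ k := by
      refine Nat.le_of_mul_le_mul_right (c := H) ?_ hH
      calc 2 * W.card * H = 2 * (W.card * H) := by ring
        _ ≤ 2 * (2 * B.card) := Nat.mul_le_mul_left _ (h3.trans h4)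
        _ = 4 * B.card := by ring
        _ ≤ k * H := hBcard
    rw [Finset.card_range] at h1
    omega
  · intro s hs
    obtain ⟨hsk, hsF⟩ := Finset.mem_filter.1 hs
    have hsk := Finset.mem_range.1 hsk
    refine ⟨(Finset.Ico (s * H) (s * H + H)).filter fun r => c r ≤ T * k ^ 2, ?_, ?_⟩
    · have h1 := Finset.card_filter_add_card_filter_not (s := Finset.Ico (s * H) (s * H + H))
        (fun r => c r ≤ T * k ^ 2)
      rw [Nat.card_Ico] at h1
      have h2 : (Finset.Ico (s * H) (s * H + H)).filter (fun r => ¬ c r ≤ T * k ^ 2) ⊆ F s := by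
        intro r hr
        obtain ⟨hr1, hr2⟩ := Finset.mem_filter.1 hr
        obtain ⟨ha, hb⟩ := Finset.mem_Ico.1 hr1
        have hle : (s + 1) * H ≤ k * H := Nat.mul_le_mul_right H hsk
        have hb' : r < (s + 1) * H := by rw [Nat.succ_mul]; exact hb
        refine Finset.mem_filter.2 ⟨Finset.mem_filter.2
          ⟨Finset.mem_range.2 (by omega), hr2⟩, ?_⟩
        exact Nat.div_eq_of_lt_le ha hb'
      have := Finset.card_le_card h2
      omega
    · intro r hr
      obtain ⟨hr1, hr2⟩ := Finset.mem_filter.1 hr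
      obtain ⟨ha, hb⟩ := Finset.mem_Ico.1 hr1
      exact ⟨ha, hb, hr2⟩

/-! ### Extending a configuration that contains a frame -/

theorem IsFrame.update {k u N H Y m : ℕ} {P : ℕ → ℤ × ℤ} (h : IsFrame k u N H Y P)
    (hm : 4 * k ≤ m) (p : ℤ × ℤ) : IsFrame k u N H Y (Function.update P m p) := by
  have e : ∀ i, i < 4 * k → Function.update P m p i = P i := fun i hi =>
    Function.update_of_ne (by omega) _ _
  constructor
  · intro i hi; rw [e i (by omega)]; exact h.arcs i hi
  · intro s hs; rw [e _ (by omega)]; exact h.left_row s hs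
  · intro s hs; rw [e _ (by omega)]; exact h.left_nonneg s hs
  · intro s hs; rw [e _ (by omega)]; exact h.left_lt s hs
  · intro s hs; rw [e _ (by omega)]; exact h.right_row s hs
  · intro s hs; rw [e _ (by omega)]; exact h.right_le s hs
  · intro s hs; rw [e _ (by omega)]; exact h.right_lt s hs

theorem InBox.update {N m : ℕ} {P : ℕ → ℤ × ℤ} (h : InBox N m P) {p : ℤ × ℤ}
    (hp : 0 ≤ p.1 ∧ p.1 < N ∧ 0 ≤ p.2 ∧ p.2 < N) : InBox N (m + 1) (Function.update P m p) := by
  intro i hi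
  by_cases him : i = m
  · subst him
    rwa [Function.update_self]
  · rw [Function.update_of_ne him]
    exact h i (by omega)

/-- Allowed columns on a fresh row of a good strip. -/
theorem exists_points_in_strip {k u N H Y T d q n m s : ℕ} {P : ℕ → ℤ × ℤ} {R : Finset ℕ}
    (hk0 : 0 < k) (hd : 1 ≤ d) (hk : 8 * k ≤ N) (hcol : ∀ i < k, 4 * arcCol u i ≤ N)
    (hdN : 4 * d ≤ N) (hT : 0 < T) (hq : 4 * T * q ≤ k ^ 2) (hnq : n ^ 2 ≤ d * q)
    (hHn : 2 * (n + 3) < H) (hY : k ≤ Y) (hYN : Y + k * H + k ≤ N) (hmn : m ≤ n) (hs : s < k)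
    (hg : IsGeneric m P) (hR : H ≤ 2 * R.card)
    (hgood : ∀ r ∈ R, s * H ≤ r ∧ r < s * H + H ∧
      (closePairs k u N d (Y + r)).card ≤ T * k ^ 2) :
    ∃ (y : ℕ) (X : Finset ℤ), Y + s * H + 3 ≤ y ∧ y < Y + s * H + H ∧ q ≤ X.card ∧
      (∀ x ∈ X, 0 ≤ x ∧ x < N ∧ IsGeneric (m + 1) (Function.update P m (x, (y : ℤ)))) ∧
      ∀ x ∈ X, ∀ x' ∈ X, x < x' → ∃ p : ℕ × ℕ, p.1 < k ∧ p.2 < k ∧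
        (x : ℝ) < crossing u N p y ∧ crossing u N p y ≤ x' := by
  classical
  -- Excluded are the occupied rows and the three lowest rows of the strip, which are too near the
  -- ladder line. Truncation of rows below `Y` by `toNat` can only exclude row offset 0 needlessly.
  let used : Finset ℕ := ((Finset.range m).image fun i => ((P i).2 - Y).toNat) ∪
    (Finset.range 3).image fun i => s * H + i
  have hused : used.card < R.card := by
    have h1 : used.card ≤ m + 3 := by
      refine (Finset.card_union_le _ _).trans (Nat.add_le_add ?_ ?_)
      · simpa using Finset.card_image_le (s := Finset.range m) (f := fun i => ((P i).2 - Y).toNat)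
      · simpa using Finset.card_image_le (s := Finset.range 3) (f := fun i => s * H + i)
    omega
  obtain ⟨r, hrR, hru⟩ := Finset.exists_mem_notMem_of_card_lt_card hused
  obtain ⟨h1, h2, h3⟩ := hgood r hrR
  simp only [used, Finset.mem_union, Finset.mem_image, Finset.mem_range, not_or, not_exists,
    not_and] at hru
  have hr3 : s * H + 3 ≤ r := by
    by_contra hlt
    exact hru.2 (r - s * H) (by omega) (by omega)
  have hfresh : ∀ i < m, (P i).2 ≠ ((Y + r : ℕ) : ℤ) := by
    intro i hi he
    refine hru.1 i hi ?_
    rw [he]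
    push_cast
    omega
  obtain ⟨K, hK, hext⟩ := hg.exists_forbidden_columns hfresh
  have hle : (s + 1) * H ≤ k * H := Nat.mul_le_mul_right H hs
  rw [Nat.succ_mul] at hle
  obtain ⟨X, hX, hX1, hX2⟩ := exists_separated_columns (y := Y + r) hk0 hd hk hcol hdN (by omega)
    (by omega) hT h3 (hK.trans ((Nat.pow_le_pow_left hmn 2).trans hnq)) hq
  refine ⟨Y + r, X, by omega, by omega, hX, fun x hx => ?_, hX2⟩
  exact ⟨(hX1 x hx).2.1, (hX1 x hx).2.2, hext x (hX1 x hx).1⟩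

theorem IsFrame.distinguishes_columns {k u N H Y y : ℕ} {P : ℕ → ℤ × ℤ} (h : IsFrame k u N H Y P)
    (hk : 8 * k ≤ N) {p : ℕ × ℕ} (h1 : p.1 < k) (h2 : p.2 < k) {x x' : ℤ}
    (hx : (x : ℝ) < crossing u N p y) (hx' : crossing u N p y ≤ x') :
    0 < orient (P p.1) (P (k + p.2)) (x, (y : ℤ)) ∧
      ¬ 0 < orient (P p.1) (P (k + p.2)) (x', (y : ℤ)) := by
  rw [h.arcs p.1 (by omega), h.arcs (k + p.2) (by omega), twoArcs_low h1, twoArcs_high,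
    orient_pos_iff_lt_crossing hk h1 h2, orient_pos_iff_lt_crossing hk h1 h2]
  exact ⟨by exact_mod_cast hx, not_lt.2 (by exact_mod_cast hx')⟩

/-- A configuration containing a frame has many one-point extensions distinguished by the frame. -/
theorem IsFrame.exists_extensions {k u N H Y T d q n m : ℕ} {P : ℕ → ℤ × ℤ} {G : Finset ℕ}
    (hk0 : 0 < k) (hd : 1 ≤ d) (hk : 8 * k ≤ N) (hcol : ∀ i < k, 4 * arcCol u i ≤ N)
    (hdN : 4 * d ≤ N) (hT : 0 < T) (hq : 4 * T * q ≤ k ^ 2) (hnq : n ^ 2 ≤ d * q)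
    (hHn : 2 * (n + 3) < H) (hY : k ≤ Y) (hYN : Y + k * H + k ≤ N) (hmn : m ≤ n)
    (hkm : 4 * k ≤ m) (hGk : G ⊆ Finset.range k) (hG : k ≤ 2 * G.card)
    (hgood : ∀ s ∈ G, ∃ R : Finset ℕ, H ≤ 2 * R.card ∧ ∀ r ∈ R, s * H ≤ r ∧ r < s * H + H ∧
      (closePairs k u N d (Y + r)).card ≤ T * k ^ 2)
    (hg : IsGeneric m P) (hbox : InBox N m P) (hf : IsFrame k u N H Y P) :
    ∃ C : Finset (ℤ × ℤ), k / 2 * q ≤ C.card ∧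
      (∀ p ∈ C, IsGeneric (m + 1) (Function.update P m p) ∧
        InBox N (m + 1) (Function.update P m p) ∧ IsFrame k u N H Y (Function.update P m p)) ∧
      ∀ p ∈ C, ∀ p' ∈ C, p ≠ p' → ∃ i j, i < j ∧ j < m ∧
        ¬ (0 < orient (P i) (P j) p ↔ 0 < orient (P i) (P j) p') := by
  classical
  have hex : ∀ s, ∃ (y : ℕ) (X : Finset ℤ), s ∈ G → Y + s * H + 3 ≤ y ∧ y < Y + s * H + H ∧
      q ≤ X.card ∧
      (∀ x ∈ X, 0 ≤ x ∧ x < N ∧ IsGeneric (m + 1) (Function.update P m (x, (y : ℤ)))) ∧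
      ∀ x ∈ X, ∀ x' ∈ X, x < x' → ∃ p : ℕ × ℕ, p.1 < k ∧ p.2 < k ∧
        (x : ℝ) < crossing u N p y ∧ crossing u N p y ≤ x' := by
    intro s
    by_cases hs : s ∈ G
    · obtain ⟨R, hR, hRg⟩ := hgood s hs
      obtain ⟨y, X, h⟩ := exists_points_in_strip hk0 hd hk hcol hdN hT hq hnq hHn hY hYN hmn
        (Finset.mem_range.1 (hGk hs)) hg hR hRg
      exact ⟨y, X, fun _ => h⟩
    · exact ⟨0, ∅, fun h => absurd h hs⟩
  choose y X hyX using hex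
  have hGlt : ∀ s ∈ G, s < k := fun s hs => Finset.mem_range.1 (hGk hs)
  have hstrip : ∀ s ∈ G, ∀ t ∈ G, s < t → y s < Y + t * H := by
    intro s hs t ht hst
    have h1 := (hyX s hs).2.1
    have h2 : (s + 1) * H ≤ t * H := Nat.mul_le_mul_right H hst
    rw [Nat.succ_mul] at h2
    omega
  let D : ℕ → Finset (ℤ × ℤ) := fun s => (X s).image fun x => (x, (y s : ℤ))
  have hD : ∀ s, (D s).card = (X s).card := fun s =>
    Finset.card_image_of_injective _ fun a b h => congrArg Prod.fst h
  have hylt : ∀ s ∈ G, ∀ t ∈ G, s < t → y s < y t := by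
    intro s hs t ht hst
    have := hstrip s hs t ht hst
    have := (hyX t ht).1
    omega
  have hdis : (G : Set ℕ).PairwiseDisjoint D := by
    intro s hs t ht hne
    rw [Function.onFun, Finset.disjoint_left]
    intro p hp hp'
    obtain ⟨x, -, rfl⟩ := Finset.mem_image.1 hp
    obtain ⟨x', -, h⟩ := Finset.mem_image.1 hp'
    have h2 : (y t : ℤ) = y s := congrArg Prod.snd h
    rcases lt_or_gt_of_ne hne with hl | hl
    · have := hylt s hs t ht hl
      omega
    · have := hylt t ht s hs hl
      omega
  have hline : ∀ s ∈ G, ∀ t ∈ G, s < t → ∀ x ∈ X s, ∀ x' ∈ X t,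
      ¬ 0 < orient (P (2 * k + t)) (P (3 * k + t)) (x, (y s : ℤ)) ∧
        0 < orient (P (2 * k + t)) (P (3 * k + t)) (x', (y t : ℤ)) := by
    intro s hs t ht hst x hx x' hx'
    have h1 := (hyX t ht).1
    have h2 := hstrip s hs t ht hst
    constructor
    · exact (hf.orient_neg (hGlt t ht) ((hyX s hs).2.2.2.1 x hx).1 (by exact_mod_cast h2)).not_gt
    · exact hf.orient_pos (hGlt t ht) ((hyX t ht).2.2.2.1 x' hx').2.1 (by exact_mod_cast h1)
  refine ⟨G.biUnion D, ?_, ?_, ?_⟩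
  · rw [Finset.card_biUnion hdis]
    calc k / 2 * q ≤ G.card * q := Nat.mul_le_mul_right q (by omega)
      _ = G.card • q := (smul_eq_mul _ _).symm
      _ ≤ ∑ s ∈ G, (D s).card := Finset.card_nsmul_le_sum _ _ _ fun s hs => by
          rw [hD]
          exact (hyX s hs).2.2.1
  · intro p hp
    obtain ⟨s, hs, hps⟩ := Finset.mem_biUnion.1 hp
    obtain ⟨x, hx, rfl⟩ := Finset.mem_image.1 hps
    obtain ⟨h0, h1, h2⟩ := (hyX s hs).2.2.2.1 x hx
    refine ⟨h2, hbox.update ⟨h0, h1, by positivity, ?_⟩, hf.update hkm _⟩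
    have h3 := (hyX s hs).2.1
    have h4 : (s + 1) * H ≤ k * H := Nat.mul_le_mul_right H (hGlt s hs)
    rw [Nat.succ_mul] at h4
    simp only
    omega
  · intro p hp p' hp' hne
    obtain ⟨s, hs, hps⟩ := Finset.mem_biUnion.1 hp
    obtain ⟨x, hx, rfl⟩ := Finset.mem_image.1 hps
    obtain ⟨t, ht, hpt⟩ := Finset.mem_biUnion.1 hp'
    obtain ⟨x', hx', rfl⟩ := Finset.mem_image.1 hpt
    -- Points in different strips are told apart by the ladder line at the bottom of the upper
    -- strip; points in the same strip share a row and are told apart by a line between the arcs.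
    rcases lt_trichotomy s t with hl | rfl | hl
    · have h := hline s hs t ht hl x hx x' hx'
      have := hGlt t ht
      exact ⟨2 * k + t, 3 * k + t, by omega, by omega, fun e => h.1 (e.2 h.2)⟩
    · rcases lt_trichotomy x x' with hl | rfl | hl
      · obtain ⟨e, h1, h2, h3, h4⟩ := (hyX s hs).2.2.2.2 x hx x' hx' hl
        have h := hf.distinguishes_columns hk h1 h2 h3 h4
        exact ⟨e.1, k + e.2, by omega, by omega, fun i => h.2 (i.1 h.1)⟩
      · exact absurd rfl hne
      · obtain ⟨e, h1, h2, h3, h4⟩ := (hyX s hs).2.2.2.2 x' hx' x hx hl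
        have h := hf.distinguishes_columns hk h1 h2 h3 h4
        exact ⟨e.1, k + e.2, by omega, by omega, fun i => h.2 (i.2 h.1)⟩
    · have h := hline t ht s hs hl x' hx' x hx
      have := hGlt s hs
      exact ⟨2 * k + s, 3 * k + s, by omega, by omega, fun e => h.1 (e.1 h.2)⟩

/-- The counting bound, in terms of the parameters of the construction. -/
theorem pow_le_gridOrderTypes {n k u Y T d q : ℕ} {α : ℝ} (hα : ((n * u : ℕ) : ℝ) ≤ (n : ℝ) ^ α)
    (hk0 : 0 < k) (hkn : 4 * k ≤ n) (hd : 1 ≤ d) (hcol : ∀ i < k, 4 * arcCol u i ≤ (n * u : ℕ))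
    (hu : 4 * (k + d) ≤ u) (hlog : 10 * (d : ℝ) * k * (1 + Real.log k) ≤ u)
    (hT : 4 * (k + n) ≤ T * k) (hq : 4 * T * q ≤ k ^ 2) (hnq : n ^ 2 ≤ d * q)
    (hun : 2 * (n + 3) < u) (hY : k ≤ Y) (hYN : 2 * (Y + k * u) ≤ n * u)
    (hkN : (4 * k) ^ 2 < n * u / 4) :
    (k / 2 * q) ^ (n - 4 * k) ≤ gridOrderTypes n α := by
  have hn4 : 4 * u ≤ n * u := Nat.mul_le_mul_right u (by omega)
  have hk8 : 8 * k ≤ n * u := by omega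
  have hkT : 0 < T := by
    rcases Nat.eq_zero_or_pos T with rfl | h
    · omega
    · exact h
  have hsum := sum_card_closePairs_le (N := n * u) (Y := Y) (M := k * u) rfl (by omega) hd hk8 hcol
    hu hYN hlog
  obtain ⟨G, hGk, hG, hgood⟩ := exists_good_strips (N := n * u) (T := T)
    (fun r => (closePairs k u (n * u) d (Y + r)).card) hk0 (by omega : 0 < u)
    (by exact_mod_cast hsum)
    (by
      calc 4 * (k * u + n * u) = 4 * (k + n) * u := by ring
        _ ≤ T * k * u := Nat.mul_le_mul_right u hT
        _ = T * (k * u) := by ring)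
  obtain ⟨P₀, hg, hbox, hf⟩ := exists_isFrame (N := n * u) (H := u) (Y := Y) (by omega : 0 < u) hk8
    hcol (by omega) hY (by omega) hkN
  obtain ⟨ι, _, F, hcard, hV, hdist⟩ := exists_family_of_extensions
    (fun m P => IsGeneric m P ∧ InBox (n * u) m P ∧ IsFrame k u (n * u) u Y P) (4 * k)
    (k / 2 * q) P₀ ⟨hg, hbox, hf⟩ (n - 4 * k)
    (fun m P hm hm' hP => hP.2.2.exists_extensions hk0 hd hk8 hcol (by omega) hkT hq hnq hun hY
      (by omega) (by omega) hm hGk hG hgood hP.1 hP.2.1)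
  rw [Nat.add_sub_cancel' hkn] at hV hdist
  rw [← hcard]
  exact card_le_gridOrderTypes hα F (fun a => (hV a).1) (fun a => (hV a).2.1) hdist

/-! ### Choice of parameters and asymptotics -/

theorem polylog_le_two_pow {L : ℕ} (hL : 64 ≤ L) : (7680 * L ^ 3) ^ 2 ≤ 2 ^ L := by
  induction L, hL using Nat.le_induction with
  | base => norm_num
  | succ L hL ih =>
    have h1 : (64 * (L + 1)) ^ 6 ≤ (65 * L) ^ 6 := Nat.pow_le_pow_left (by omega) 6
    have h2 : (L + 1) ^ 6 ≤ 2 * L ^ 6 := by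
      rw [mul_pow, mul_pow] at h1
      norm_num at h1
      omega
    calc (7680 * (L + 1) ^ 3) ^ 2 = 7680 ^ 2 * (L + 1) ^ 6 := by ring
      _ ≤ 7680 ^ 2 * (2 * L ^ 6) := Nat.mul_le_mul_left _ h2
      _ = 2 * (7680 * L ^ 3) ^ 2 := by ring
      _ ≤ 2 * 2 ^ L := Nat.mul_le_mul_left 2 ih
      _ = 2 ^ (L + 1) := by ring

theorem polylog_le_sqrt {n : ℕ} (hn : 2 ^ 64 ≤ n) :
    64 ≤ Nat.log 2 n ∧ 7680 * Nat.log 2 n ^ 3 ≤ Nat.sqrt n := by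
  have hL : 64 ≤ Nat.log 2 n := Nat.le_log_of_pow_le (by norm_num) hn
  refine ⟨hL, Nat.le_sqrt'.2 ((polylog_le_two_pow hL).trans (Nat.pow_log_le_self 2 ?_))⟩
  have : 0 < 2 ^ 64 := by positivity
  omega

theorem log_bounds_of_nat_log {n : ℕ} (hL : 64 ≤ Nat.log 2 n) :
    (Nat.log 2 n : ℝ) ≤ 2 * Real.log n ∧ Real.log n ≤ Nat.log 2 n + 1 := by
  have hn0 : n ≠ 0 := by
    rintro rfl
    simp at hL
  have hn : (0 : ℝ) < n := by exact_mod_cast Nat.pos_of_ne_zero hn0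
  have l1 := Real.log_two_gt_d9
  have l2 := Real.log_two_lt_d9
  have hL0 : (0 : ℝ) ≤ Nat.log 2 n := Nat.cast_nonneg _
  constructor
  · have h1 : ((2 : ℝ) ^ Nat.log 2 n) ≤ n := by exact_mod_cast Nat.pow_log_le_self 2 hn0
    have h2 := Real.log_le_log (by positivity) h1
    rw [Real.log_pow] at h2
    nlinarith
  · have h1 : (n : ℝ) ≤ (2 : ℝ) ^ (Nat.log 2 n + 1) := by
      exact_mod_cast (Nat.lt_pow_succ_log_self (by norm_num) n).le
    have h2 := Real.log_le_log hn h1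
    rw [Real.log_pow] at h2
    push_cast at h2
    nlinarith

/-- The main counting bound with all parameters chosen in terms of `n`. -/
theorem exists_pow_le_gridOrderTypes {n : ℕ} {α : ℝ} (hα : 5 / 2 ≤ α) (hn : 2 ^ 64 ≤ n) :
    ∃ k Q : ℕ, k * Nat.log 2 n ≤ n ∧ 4 * k ≤ n ∧ n ^ 3 ≤ 3072 * Nat.log 2 n ^ 4 * Q ∧
      Q ^ (n - 4 * k) ≤ gridOrderTypes n α := by
  obtain ⟨hL, hs⟩ := polylog_le_sqrt hn
  obtain ⟨-, hlogn⟩ := log_bounds_of_nat_log hL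
  have hsn : Nat.sqrt n * Nat.sqrt n ≤ n := Nat.sqrt_le n
  set L := Nat.log 2 n with hLdef
  set s := Nat.sqrt n with hsdef
  have hL3 : 64 * (L * L) ≤ L ^ 3 := by
    calc 64 * (L * L) ≤ L * (L * L) := Nat.mul_le_mul_right _ hL
      _ = L ^ 3 := by ring
  have hLL : 64 * L ≤ L * L := Nat.mul_le_mul_right _ hL
  have hsL : 7680 * (64 * 64 * L) ≤ s := by omega
  have hsn' : s * s ≤ n := hsn
  have hsn1 : 7680 * (64 * 64 * L) * s ≤ s * s := Nat.mul_le_mul_right _ hsL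
  have hLs : 1 * s ≤ L * s := Nat.mul_le_mul_right _ (by omega)
  have hbig : 7680 * 64 * 64 * s ≤ n := by
    calc 7680 * 64 * 64 * s = 7680 * 64 * 64 * (1 * s) := by ring
      _ ≤ 7680 * 64 * 64 * (L * s) := Nat.mul_le_mul_left _ hLs
      _ = 7680 * (64 * 64 * L) * s := by ring
      _ ≤ n := hsn1.trans hsn'
  -- The frame must be a vanishing fraction of the points, yet `k ^ 3` may lose only logarithmic
  -- factors against `n ^ 3`.
  set k := n / L with hk
  have hkL : k * L ≤ n := Nat.div_mul_le_self n L
  have hk64 : k * 64 ≤ n := (Nat.mul_le_mul_left k hL).trans hkL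
  have hk1 : 64 ≤ k := by
    rw [hk, Nat.le_div_iff_mul_le (by omega)]
    omega
  have hnk : n ≤ 2 * L * k := by
    have h1 : n < (k + 1) * L := by
      have := Nat.lt_mul_div_succ n (show 0 < L by omega)
      rw [← hk] at this
      rwa [mul_comm]
    calc n ≤ (k + 1) * L := h1.le
      _ ≤ (k + k) * L := Nat.mul_le_mul_right _ (by omega)
      _ = 2 * L * k := by ring
  -- Two demands meet here: `d` must be at least `384 * L ^ 3`, so that forbidden columns block at
  -- most `q` bins, and `20 * d ≤ s` makes the close-pair sum small. The factor 7680 in `hs` is `20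
  -- * 384`.
  set d := s / 20 with hd
  have hd384 : 384 * L ^ 3 ≤ d := by omega
  have hd20 : 20 * d ≤ s := by omega
  set q := k ^ 2 / (48 * L) with hq
  have hq1 : 48 * L * q ≤ k ^ 2 := Nat.mul_div_le _ _
  have hnq : n ^ 2 ≤ 384 * L ^ 3 * q := by
    have hkL2 : 48 * L ≤ k ^ 2 := by
      have h1 : 64 * k ≤ k ^ 2 := by rw [sq]; exact Nat.mul_le_mul_right _ hk1
      have h2 : L ≤ k := by
        rw [hk, Nat.le_div_iff_mul_le (by omega)]
        have : L * L ≤ s * s := Nat.mul_le_mul (by omega) (by omega)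
        omega
      omega
    have h0 : 1 ≤ q := by
      rw [hq, Nat.le_div_iff_mul_le (by omega)]
      omega
    have h1 : k ^ 2 ≤ 48 * L * (q + 1) := (Nat.lt_mul_div_succ (k ^ 2) (show 0 < 48 * L by omega)).le
    calc n ^ 2 ≤ (2 * L * k) ^ 2 := Nat.pow_le_pow_left hnk 2
      _ = 4 * L ^ 2 * k ^ 2 := by ring
      _ ≤ 4 * L ^ 2 * (48 * L * (q + q)) :=
        Nat.mul_le_mul_left _ (h1.trans (Nat.mul_le_mul_left _ (by omega)))
      _ = 384 * L ^ 3 * q := by ring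
  have hns : 1000 * n ≤ n * s := by
    rw [mul_comm]
    exact Nat.mul_le_mul_left n (by omega)
  have hnn : n * n * 1000 ≤ n * (n * s) := by
    calc n * n * 1000 = n * (1000 * n) := by ring
      _ ≤ n * (n * s) := Nat.mul_le_mul_left n hns
  have hn1 : n ≤ n * n := Nat.le_mul_self n
  have hkk : k * k * 4096 ≤ n * n := by
    calc k * k * 4096 = (k * 64) * (k * 64) := by ring
      _ ≤ n * n := Nat.mul_le_mul hk64 hk64
  have hku : k * (n * s) * 64 ≤ n * (n * s) := by
    calc k * (n * s) * 64 = k * 64 * (n * s) := by ring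
      _ ≤ n * (n * s) := Nat.mul_le_mul_right _ hk64
  refine ⟨k, k / 2 * q, hkL, by omega, ?_, ?_⟩
  · calc n ^ 3 = n * n ^ 2 := by ring
      _ ≤ (2 * L * (4 * (k / 2))) * (384 * L ^ 3 * q) :=
        Nat.mul_le_mul (hnk.trans (Nat.mul_le_mul_left _ (by omega))) hnq
      _ = 3072 * L ^ 4 * (k / 2 * q) := by ring
  -- The grid side is `n * (n * s)`, at most `n ^ (5 / 2)`. The value of `T` comes from `n ≤ 2 * L *
  -- k`, which gives `4 * (k + n) ≤ 12 * L * k`; then `4 * T` is the divisor `48 * L` in `q`.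
  · refine pow_le_gridOrderTypes (u := n * s) (Y := k) (T := 12 * L) (d := d) ?_ (by omega)
      (by omega) (by omega) ?_ (by omega) ?_ ?_ ?_ ?_ (by omega) le_rfl ?_ ?_
    · have hn1 : (1 : ℝ) ≤ n := by exact_mod_cast (by omega : 1 ≤ n)
      have hs2 : (s : ℝ) ≤ Real.sqrt n := Real.nat_sqrt_le_real_sqrt
      calc ((n * (n * s) : ℕ) : ℝ) = (n : ℝ) ^ 2 * s := by push_cast; ring
        _ ≤ (n : ℝ) ^ 2 * Real.sqrt n := mul_le_mul_of_nonneg_left hs2 (by positivity)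
        _ = (n : ℝ) ^ (5 / 2 : ℝ) := by
          rw [Real.sqrt_eq_rpow, ← Real.rpow_natCast, ← Real.rpow_add (by linarith)]
          norm_num
        _ ≤ (n : ℝ) ^ α := Real.rpow_le_rpow_of_exponent_le hn1 hα
    · intro i hi
      unfold arcCol
      have h1 : n * s * i ≤ n * s * k := Nat.mul_le_mul_left _ hi.le
      have h2 : i ^ 2 ≤ k * k := by rw [sq]; exact Nat.mul_le_mul hi.le hi.le
      have h3 : n * s * k = k * (n * s) := by ring
      have h4 : 4 * (n * s * i + i ^ 2) ≤ n * (n * s) := by omega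
      exact_mod_cast h4
    · have hk0 : (1 : ℝ) ≤ k := by exact_mod_cast (by omega : 1 ≤ k)
      have hkn : (k : ℝ) ≤ n := by exact_mod_cast (by omega : k ≤ n)
      have h1 : Real.log k ≤ Real.log n := Real.log_le_log (by linarith) hkn
      have hLr : (64 : ℝ) ≤ L := by exact_mod_cast hL
      have h2 : 1 + Real.log k ≤ 2 * L := by linarith
      have h3 : 20 * d * (k * L) ≤ n * s := by
        calc 20 * d * (k * L) ≤ s * n := Nat.mul_le_mul hd20 hkL
          _ = n * s := by ring
      calc 10 * (d : ℝ) * k * (1 + Real.log k) ≤ 10 * (d : ℝ) * k * (2 * L) :=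
            mul_le_mul_of_nonneg_left h2 (by positivity)
        _ = ((20 * d * (k * L) : ℕ) : ℝ) := by push_cast; ring
        _ ≤ ((n * s : ℕ) : ℝ) := by exact_mod_cast h3
    · have h1 : 64 * k ≤ L * k := Nat.mul_le_mul_right _ hL
      have h2 : 2 * L * k = 2 * (L * k) := by ring
      have h3 : 12 * L * k = 12 * (L * k) := by ring
      omega
    · calc 4 * (12 * L) * q = 48 * L * q := by ring
        _ ≤ k ^ 2 := hq1
    · exact hnq.trans (Nat.mul_le_mul_right q hd384)
    · have : 2 * (k + k * (n * s)) = 2 * k + 2 * (k * (n * s)) := by ring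
      omega
    · have : (4 * k) ^ 2 = 16 * (k * k) := by ring
      omega

/-- Both losses are O(n log log n): the polylogarithmic factor in `Q` costs at most `13 + 4 * log
(log n)` per point, and the `4 * k` frame points cost `12 * k * log n ≤ 24 * n`. Since `log (log n)
≥ 1`, the constant is 24 + 13 + 4 = 41. -/
theorem exp_le_pow_of_cube_le {n k L Q : ℕ} (hL : 64 ≤ L) (hL2 : (L : ℝ) ≤ 2 * Real.log n)
    (hlogn : Real.log n ≤ L + 1) (hkL : k * L ≤ n) (hkn : 4 * k ≤ n)
    (hQ : n ^ 3 ≤ 3072 * L ^ 4 * Q) (hn : 0 < n) :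
    Real.exp (3 * (n : ℝ) * Real.log n - 41 * ((n : ℝ) * Real.log (Real.log n))) ≤
      (Q : ℝ) ^ (n - 4 * k) := by
  have hLr : (64 : ℝ) ≤ L := by exact_mod_cast hL
  have hnr : (0 : ℝ) < n := by exact_mod_cast hn
  have hQ0 : 0 < Q := by
    rcases Nat.eq_zero_or_pos Q with rfl | h
    · have : 0 < n ^ 3 := by positivity
      omega
    · exact h
  have hQr : (0 : ℝ) < Q := by exact_mod_cast hQ0
  have hlog32 : 32 ≤ Real.log n := by linarith
  have hll : 1 ≤ Real.log (Real.log n) := by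
    rw [Real.le_log_iff_exp_le (by linarith)]
    linarith [Real.exp_one_lt_d9]
  have hlogL : Real.log L ≤ 1 + Real.log (Real.log n) := by
    have h1 := Real.log_le_log (by linarith) hL2
    rw [Real.log_mul (by norm_num) (by linarith)] at h1
    linarith [Real.log_two_lt_d9]
  have h3072 : Real.log 3072 ≤ 9 := by
    have h1 : Real.log 3072 ≤ Real.log ((2 : ℝ) ^ 12) := Real.log_le_log (by norm_num) (by norm_num)
    rw [Real.log_pow] at h1
    push_cast at h1
    linarith [Real.log_two_lt_d9]
  have hlogQ : 3 * Real.log n - (13 + 4 * Real.log (Real.log n)) ≤ Real.log Q := by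
    have h1 : ((n : ℝ) ^ 3) ≤ 3072 * (L : ℝ) ^ 4 * Q := by exact_mod_cast hQ
    have h2 := Real.log_le_log (by positivity) h1
    rw [Real.log_pow, Real.log_mul (by positivity) hQr.ne', Real.log_mul (by norm_num) (by positivity),
      Real.log_pow] at h2
    push_cast at h2
    linarith
  rw [← Real.exp_log hQr, ← Real.exp_nat_mul, Real.exp_le_exp, Nat.cast_sub hkn]
  push_cast
  have hkn' : 4 * (k : ℝ) ≤ n := by exact_mod_cast hkn
  have hkL' : (k : ℝ) * L ≤ n := by exact_mod_cast hkL
  have hk0 : (0 : ℝ) ≤ k := Nat.cast_nonneg k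
  have h1 := mul_le_mul_of_nonneg_left hlogQ (by linarith : (0 : ℝ) ≤ n - 4 * k)
  have h2 : (k : ℝ) * Real.log n ≤ 2 * n := by
    have := mul_le_mul_of_nonneg_left (by linarith : Real.log n ≤ 2 * L) hk0
    linarith
  have h3 : 0 ≤ (k : ℝ) * (13 + 4 * Real.log (Real.log n)) :=
    mul_nonneg hk0 (by linarith)
  have h4 : (n : ℝ) * 1 ≤ n * Real.log (Real.log n) := mul_le_mul_of_nonneg_left hll hnr.le
  nlinarith

theorem theorem2 :
    ∃ C : ℝ, 0 < C ∧ ∃ n₀ : ℕ, ∀ α : ℝ, 5 / 2 ≤ α → ∀ n : ℕ, n₀ ≤ n →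
      Real.exp (3 * (n : ℝ) * Real.log (n : ℝ) - C * ((n : ℝ) * Real.log (Real.log (n : ℝ)))) ≤
        (gridOrderTypes n α : ℝ) := by
  refine ⟨41, by norm_num, 2 ^ 64, fun α hα n hn => ?_⟩
  obtain ⟨k, Q, hkL, hkn, hQ, hle⟩ := exists_pow_le_gridOrderTypes hα hn
  obtain ⟨hL, -⟩ := polylog_le_sqrt hn
  obtain ⟨h1, h2⟩ := log_bounds_of_nat_log hL
  have hn0 : 0 < n := lt_of_lt_of_le (by positivity) hn
  exact (exp_le_pow_of_cube_le hL h1 h2 hkL hkn hQ hn0).trans (by exact_mod_cast hle)
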